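/- **Proposition 3.3 (stability for the Dirichlet problem).** Let $(X,d)$ be a complete metric space with a Borel measure $\mu$ that is doubling (there is $c_d>0$ with $0<\mu(B(x,2r))\le c_d\,\mu(B(x,r))<\infty$ for all $x\in X$, $r>0$) and supports a $(1,1)$-Poincaré inequality: there are $c_P>0$ and $\lambda\ge 1$ such that for every ball $B(x,r)$, every locally integrable $u$ on $X$ and every upper gradient $g$ of $u$, $$\frac1{\mu(B(x,r))}\int_{B(x,r)}|u-u_{B(x,r)}|\,d\mu\le c_P\,r\,\frac1{\mu(B(x,\lambda r))}\int_{B(x,\lambda r)}g\,d\mu ,$$ where $u_{B(x,r)}$ is the mean value of $u$ over $B(x,r)$. Here an upper gradient of $u$ in a set $U\subset X$ is a nonnegative (possibly infinite-valued) Borel function $g$ such that $|u(x)-u(y)|\le\int_\gamma g\,ds$ for every rectifiable curve $\gamma$ in $U$ with end points $x,y$; if $U$ is not mentioned, $U=X$. For $U\subset X$ open, $u\in N^{1,1}(U)$ means that $u$ is integrable on $U$ and has an upper gradient in $U$ that is integrable on $U$; $N^{1,1}_{\rm loc}(U)$ and $L^1_{\rm loc}(U)$ refer to all open $V$ whose closure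 is a compact subset of $U$. The total variation of $u\in L^1(X)$ on an open set $U$ is $$\|Du\|(U)=\inf\Bigl\{\liminf_{i\to\infty}\int_U g_i\,d\mu\Bigr\},$$ the infimum being over all sequences $v_i\in N^{1,1}_{\rm loc}(U)$ with $v_i\to u$ in $L^1_{\rm loc}(U)$ and all upper gradients $g_i$ of $v_i$ in $U$. For arbitrary $A\subset X$, $\|Du\|(A)=\inf\{\|Du\|(U): U\supset A \text{ open}\}$. We write $u\in BV(X)$ if $u\in L^1(X)$ and $\|Du\|(X)<\infty$. For $\Omega\subset X$ open, $BV_0(\Omega)$ is the set of $g\in BV(X)$ with $g=0$ $\mu$-a.e. in $X\setminus\Omega$. For $f\in BV(X)$, a function $u\in BV(X)$ is a solution to the Dirichlet problem for least gradients in $\Omega$ with boundary data $f$ if $u-f\in BV_0(\Omega)$ and $\|Du\|(\overline\Omega)\le\|D(u+g)\|(\overline\Omega)$ for every $g\in BV_0(\Omega)$. Let $\Omega\subset X$ be a bounded open set with $\mu(X\setminus\Omega)>0$. Let $f\in BV(X)$ and $f_k\in BV(X)$, $k\in\mathbb N$, with $f_k\to f$ in $BV(X)$, that is, $\|f_k-f\|_{L^1(X)}+\|D(f_k-f)\|(X)\to0$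 as $k\to\infty$. Suppose that each $u_k\in BV(X)$ is a solution to the Dirichlet problem for least gradients in $\Omega$ with boundary data $f_k$. Then there is a function $u\in BV(X)$ such that a subsequence of $(u_k)$ converges to $u$ in $L^1(\Omega)$, and $u$ is a solution to the Dirichlet problem for least gradients in $\Omega$ with boundary data $f$. -/

import Mathlib

open MeasureTheory Filter Topology Set
open scoped ENNReal NNReal

noncomputable section

namespace MetricBV

variable {X : Type*} [MetricSpace X] [MeasurableSpace X]

/-- A doubling measure: `0 < μ(B(x,2r)) ≤ c_d μ(B(x,r)) < ∞` for all balls, at all scales. -/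
def IsDoubling (μ : Measure X) : Prop :=
  ∃ cd : ℝ≥0, ∀ (x : X) (r : ℝ), 0 < r →
    0 < μ (Metric.ball x (2 * r)) ∧
    μ (Metric.ball x (2 * r)) ≤ cd * μ (Metric.ball x r) ∧
    μ (Metric.ball x r) < ∞

/-- The length of the restriction of `γ` to the interval `[a, b]`. -/
def curveLength (γ : ℝ → X) (a b : ℝ) : ℝ≥0∞ := eVariationOn γ (Icc a b)

/-- The curve integral `∫_γ g ds` over `γ : [a, b] → X`, i.e. the integral of `g` along the
arc length parametrization of `γ`. -/
def arcLengthIntegral (g : X → ℝ≥0∞) (γ : ℝ → X) (a b : ℝ) : ℝ≥0∞ :=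
  ∫⁻ s in Icc 0 (curveLength γ a b).toReal, g (naturalParameterization γ (Icc a b) a s)

/-- `g` is an upper gradient of `u` in `U`: `g` is a nonnegative (possibly infinite-valued) Borel
function and `|u(γ(a)) - u(γ(b))| ≤ ∫_γ g ds` for every rectifiable curve `γ : [a, b] → U`. -/
def IsUpperGradientOn (u : X → ℝ) (g : X → ℝ≥0∞) (U : Set X) : Prop :=
  Measurable g ∧
    ∀ (γ : ℝ → X) (a b : ℝ), a ≤ b → ContinuousOn γ (Icc a b) → MapsTo γ (Icc a b) U →
      curveLength γ a b < ∞ →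
      ‖u (γ a) - u (γ b)‖ₑ ≤ arcLengthIntegral g γ a b

/-- `V ⋐ U`: `V` is open and its closure is a compact subset of `U`. -/
def CompactlyInside (V U : Set X) : Prop :=
  IsOpen V ∧ IsCompact (closure V) ∧ closure V ⊆ U

/-- The `(1,1)`-Poincaré inequality. -/
def SupportsPoincare (μ : Measure X) : Prop :=
  ∃ cP lam : ℝ, 0 < cP ∧ 1 ≤ lam ∧
    ∀ (x : X) (r : ℝ), 0 < r →
      ∀ (u : X → ℝ) (g : X → ℝ≥0∞), LocallyIntegrable u μ → IsUpperGradientOn u g univ →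
        (⨍⁻ y in Metric.ball x r, ‖u y - ⨍ z in Metric.ball x r, u z ∂μ‖ₑ ∂μ) ≤
          ENNReal.ofReal (cP * r) * ⨍⁻ y in Metric.ball x (lam * r), g y ∂μ

/-- `u ∈ N^{1,1}(U)`: `u` is integrable on `U` and has an upper gradient in `U` that is
integrable on `U`. -/
def MemNewtonian (μ : Measure X) (u : X → ℝ) (U : Set X) : Prop :=
  IntegrableOn u U μ ∧
    ∃ g : X → ℝ≥0∞, IsUpperGradientOn u g U ∧ ∫⁻ x in U, g x ∂μ < ∞

/-- `u ∈ N^{1,1}_loc(U)`. -/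
def MemNewtonianLoc (μ : Measure X) (u : X → ℝ) (U : Set X) : Prop :=
  ∀ V : Set X, CompactlyInside V U → MemNewtonian μ u V

/-- `v i → u` in `L^1(U)`. -/
def TendstoL1 (μ : Measure X) (v : ℕ → X → ℝ) (u : X → ℝ) (U : Set X) : Prop :=
  Tendsto (fun i => ∫⁻ x in U, ‖v i x - u x‖ₑ ∂μ) atTop (𝓝 0)

/-- `v i → u` in `L^1_loc(U)`. -/
def TendstoL1Loc (μ : Measure X) (v : ℕ → X → ℝ) (u : X → ℝ) (U : Set X) : Prop :=
  ∀ V : Set X, CompactlyInside V U → TendstoL1 μ v u V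

/-- The total variation `‖Du‖(U)` for open `U`: the infimum of `liminf ∫_U g i dμ` over all
sequences `v i ∈ N^{1,1}_loc(U)` with `v i → u` in `L^1_loc(U)` and all upper gradients `g i`
of `v i` in `U`. -/
def variationOpen (μ : Measure X) (u : X → ℝ) (U : Set X) : ℝ≥0∞ :=
  ⨅ (v : ℕ → X → ℝ) (g : ℕ → X → ℝ≥0∞) (_ : ∀ i, MemNewtonianLoc μ (v i) U)
    (_ : ∀ i, IsUpperGradientOn (v i) (g i) U) (_ : TendstoL1Loc μ v u U),
    liminf (fun i => ∫⁻ x in U, g i x ∂μ) atTop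

/-- The total variation `‖Du‖(A)` for an arbitrary set `A`. -/
def variation (μ : Measure X) (u : X → ℝ) (A : Set X) : ℝ≥0∞ :=
  ⨅ (U : Set X) (_ : IsOpen U) (_ : A ⊆ U), variationOpen μ u U

/-- `u ∈ BV(X)`. -/
def MemBV (μ : Measure X) (u : X → ℝ) : Prop :=
  Integrable u μ ∧ variation μ u univ < ∞

/-- `g ∈ BV_0(Ω)`: `g ∈ BV(X)` and `g = 0` a.e. in `X \ Ω`. -/
def MemBVZero (μ : Measure X) (Ω : Set X) (g : X → ℝ) : Prop :=
  MemBV μ g ∧ ∀ᵐ x ∂μ, x ∉ Ω → g x = 0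

/-- `f k → f` in `BV(X)`. -/
def TendstoBV (μ : Measure X) (f : ℕ → X → ℝ) (f₀ : X → ℝ) : Prop :=
  Tendsto (fun k => (∫⁻ x, ‖f k x - f₀ x‖ₑ ∂μ) + variation μ (f k - f₀) univ) atTop (𝓝 0)

/-- `u` solves the Dirichlet problem for least gradients in `Ω` with boundary data `f`. -/
def SolvesDirichlet (μ : Measure X) (Ω : Set X) (f u : X → ℝ) : Prop :=
  MemBV μ u ∧ MemBVZero μ Ω (u - f) ∧
    ∀ g : X → ℝ, MemBVZero μ Ω g →
      variation μ u (closure Ω) ≤ variation μ (u + g) (closure Ω)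

end MetricBV

end

/-! The differences `u k - f k` vanish off `Ω`, and everything is done with them. Testing minimality
of `u k` against the competitor `f k` bounds the variation of `u k` on `closure Ω` by that of `f k`.
A function vanishing off `closure Ω` carries its variation there, so the differences have total
variation at most twice that of `f k`, which is eventually bounded. The Poincaré inequality on a
ball that contains `Ω` and a set of positive measure outside it then bounds their L¹ norms. A
Rellich argument (averages over small balls, with bounded overlap from doubling) extracts a
subsequence converging in L¹ to some `v₀` vanishing off `Ω`, and the solution is `u₀ = f₀ + v₀`.

For minimality, the functions `u k - (f k - f₀)` converge to `u₀` in L¹, equal `u₀` off `Ω`, and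
have almost the variation of `u k`. A competitor for `u₀` becomes one for `u k` after adding `f k -
f₀`. What remains is lower semicontinuity on the closed set `closure Ω`, where it fails in general.
It holds here because the outer values are fixed: some thin collar around `closure Ω` carries little
variation of `u₀`, hence little of each approximant, and gluing across the collar reduces the claim
to an open set.

The total variation is never shown to be a measure. Superadditivity on disjoint open sets, and
subadditivity for two open sets overlapping in a compact collar, are enough. The latter rests on a
Leibniz rule for upper gradients, proved by subdividing curves into short pieces.

The carrying lemmas are `IsUpperGradientOn.convexComb`, `variationOpen_le_add_of_collar`,
`variation_compact_le_of_tendsto`, `exists_lintegral_le_mul_variationOpen`,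
`exists_subseq_tendstoL1` and `solvesDirichlet_of_tendsto`. -/

namespace MetricBV

/-! ### Arc length parametrization and the calculus of upper gradients -/

section Curves

variable {X : Type*} [MetricSpace X]

/-- Arc length is continuous along a continuous rectifiable curve, so it skips no value; hence the
natural parametrization has unit speed on a full interval. -/
theorem image_variationOnFromTo_Icc {γ : ℝ → X} {a b : ℝ} (hab : a ≤ b)
    (hc : ContinuousOn γ (Icc a b)) (hl : eVariationOn γ (Icc a b) ≠ ∞) :
    variationOnFromTo γ (Icc a b) a '' Icc a b = Icc 0 (eVariationOn γ (Icc a b)).toReal := by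
  have hbv : BoundedVariationOn γ (Icc a b) := hl
  have hloc := hbv.locallyBoundedVariationOn
  have ha : a ∈ Icc a b := left_mem_Icc.2 hab
  have hb : b ∈ Icc a b := right_mem_Icc.2 hab
  have hmono := variationOnFromTo.monotoneOn hloc ha
  have hend : variationOnFromTo γ (Icc a b) a b = (eVariationOn γ (Icc a b)).toReal := by
    rw [variationOnFromTo.eq_of_le _ _ hab, inter_self]
  have hcont : ContinuousOn (variationOnFromTo γ (Icc a b) a) (Icc a b) := by
    intro x hx
    have key : Tendsto (fun y => (eVariationOn γ (Icc a b ∩ Icc y x)).toReal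
        + (eVariationOn γ (Icc a b ∩ Icc x y)).toReal) (𝓝[Icc a b] x) (𝓝 0) := by
      have h1 := hbv.tendsto_eVariationOn_Icc_zero_left
        ((hc x hx).mono (inter_subset_left (t := Iic x)))
      have h2 := hbv.tendsto_eVariationOn_Icc_zero_right x
        ((hc x hx).mono (inter_subset_left (t := Ici x)))
      simpa using ((ENNReal.tendsto_toReal ENNReal.zero_ne_top).comp h1).add
        ((ENNReal.tendsto_toReal ENNReal.zero_ne_top).comp h2)
    rw [ContinuousWithinAt, tendsto_iff_dist_tendsto_zero]
    refine squeeze_zero' (Eventually.of_forall fun _ => dist_nonneg) ?_ key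
    filter_upwards [self_mem_nhdsWithin] with y hy
    rw [Real.dist_eq, variationOnFromTo.sub_right hloc ha hy hx]
    rcases le_total x y with h | h
    · rw [variationOnFromTo.eq_of_le _ _ h, abs_of_nonneg ENNReal.toReal_nonneg]
      exact le_add_of_nonneg_left ENNReal.toReal_nonneg
    · rw [variationOnFromTo.eq_of_ge _ _ h, abs_neg, abs_of_nonneg ENNReal.toReal_nonneg]
      exact le_add_of_nonneg_right ENNReal.toReal_nonneg
  apply Subset.antisymm
  · rintro _ ⟨t, ht, rfl⟩
    refine ⟨variationOnFromTo.nonneg_of_le _ _ ht.1, ?_⟩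
    rw [← hend]
    exact hmono ht hb ht.2
  · have := intermediate_value_Icc hab hcont
    rwa [variationOnFromTo.self, hend] at this

theorem HasUnitSpeedOn.edist_le {γ : ℝ → X} {S : Set ℝ} (h : HasUnitSpeedOn γ S) {s t : ℝ}
    (hs : s ∈ S) (ht : t ∈ S) (hst : s ≤ t) : edist (γ s) (γ t) ≤ ENNReal.ofReal (t - s) := by
  have h1 := h hs ht
  rw [NNReal.coe_one, one_mul] at h1
  rw [← h1]
  exact eVariationOn.edist_le γ ⟨hs, le_rfl, hst⟩ ⟨ht, hst, le_rfl⟩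

theorem HasUnitSpeedOn.dist_le {γ : ℝ → X} {S : Set ℝ} (h : HasUnitSpeedOn γ S) {s t : ℝ}
    (hs : s ∈ S) (ht : t ∈ S) (hst : s ≤ t) : dist (γ s) (γ t) ≤ t - s := by
  have := HasUnitSpeedOn.edist_le h hs ht hst
  rwa [edist_dist, ENNReal.ofReal_le_ofReal_iff (sub_nonneg.2 hst)] at this

theorem HasUnitSpeedOn.continuousOn {γ : ℝ → X} {S : Set ℝ} (h : HasUnitSpeedOn γ S) :
    ContinuousOn γ S := by
  have : LipschitzOnWith 1 γ S := by
    apply LipschitzOnWith.of_dist_le_mul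
    intro s hs t ht
    rcases le_total s t with hst | hst
    · simpa [Real.dist_eq, abs_of_nonpos (sub_nonpos.2 hst)] using HasUnitSpeedOn.dist_le h hs ht hst
    · rw [dist_comm]
      simpa [Real.dist_eq, abs_of_nonneg (sub_nonneg.2 hst)] using HasUnitSpeedOn.dist_le h ht hs hst
  exact this.continuousOn

theorem HasUnitSpeedOn.mono_Icc {γ : ℝ → X} {c d c' d' : ℝ} (h : HasUnitSpeedOn γ (Icc c d))
    (hsub : Icc c' d' ⊆ Icc c d) : HasUnitSpeedOn γ (Icc c' d') := by
  intro s hs t ht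
  rw [← h (hsub hs) (hsub ht)]
  congr 1
  ext x
  simp only [mem_inter_iff, mem_Icc] at *
  refine ⟨fun hx => ⟨hsub hx.1, hx.2⟩, fun hx => ⟨⟨hs.1.trans hx.2.1, hx.2.2.trans ht.2⟩, hx.2⟩⟩

theorem arcLengthIntegral_of_hasUnitSpeedOn (g : X → ℝ≥0∞) {γ : ℝ → X} {c d : ℝ} (hcd : c ≤ d)
    (h : HasUnitSpeedOn γ (Icc c d)) :
    arcLengthIntegral g γ c d = ∫⁻ s in Icc c d, g (γ s) := by
  have hc : c ∈ Icc c d := left_mem_Icc.2 hcd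
  have hlen : curveLength γ c d = ENNReal.ofReal (d - c) := by
    have := h hc (right_mem_Icc.2 hcd)
    rwa [inter_self, NNReal.coe_one, one_mul] at this
  have hV : ∀ t ∈ Icc c d, variationOnFromTo γ (Icc c d) c t = t - c := by
    intro t ht
    have := (hasConstantSpeedOnWith_iff_variationOnFromTo_eq.1 h).2 hc ht
    rwa [NNReal.coe_one, one_mul] at this
  -- At unit speed the arc length function is translation by `-c`, so its chosen inverse is
  -- translation by `c`.
  have hnat : ∀ s ∈ Icc 0 (d - c), naturalParameterization γ (Icc c d) c s = γ (s + c) := by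
    intro s hs
    have hmem : s + c ∈ Icc c d := ⟨by linarith [hs.1], by linarith [hs.2]⟩
    have hex : ∃ t ∈ Icc c d, variationOnFromTo γ (Icc c d) c t = s :=
      ⟨s + c, hmem, by rw [hV _ hmem]; ring⟩
    have h1 := Function.invFunOn_mem hex
    have h2 := Function.invFunOn_eq hex
    rw [hV _ h1] at h2
    rw [naturalParameterization, Function.comp_apply]
    congr 1
    linarith
  rw [arcLengthIntegral, hlen, ENNReal.toReal_ofReal (sub_nonneg.2 hcd),
    setLIntegral_congr_fun (g := fun s => g (γ (s + c))) measurableSet_Icc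
      (fun s hs => by simp only [hnat s hs])]
  have hmp := (measurePreserving_add_right (volume : Measure ℝ) c).setLIntegral_comp_preimage_emb
    (measurableEmbedding_addRight c) (fun s => g (γ s)) (Icc c d)
  rw [← hmp]
  congr 2
  ext s
  simp

theorem setLIntegral_Icc_add_Icc (H : ℝ → ℝ≥0∞) {a b c : ℝ} (hab : a ≤ b) (hbc : b ≤ c) :
    (∫⁻ s in Icc a b, H s) + ∫⁻ s in Icc b c, H s = ∫⁻ s in Icc a c, H s := by
  rw [← Measure.restrict_congr_set (Ioc_ae_eq_Icc (a := b) (b := c) (μ := volume)),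
    ← lintegral_union measurableSet_Ioc, Icc_union_Ioc_eq_Icc hab hbc]
  exact Set.disjoint_left.2 fun x hx hx' => absurd hx.2 (not_le.2 hx'.1)

/-- An increment bound by an integral that holds locally holds globally. -/
theorem enorm_sub_le_setLIntegral_of_local {F : ℝ → ℝ} {H : ℝ → ℝ≥0∞} {c d : ℝ} (hcd : c ≤ d)
    (h : ∀ t ∈ Icc c d, ∃ δ > 0, ∀ s s', s ≤ s' → s ∈ Icc c d → s' ∈ Icc c d →
      dist s t < δ → dist s' t < δ → ‖F s - F s'‖ₑ ≤ ∫⁻ x in Icc s s', H x) :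
    ‖F c - F d‖ₑ ≤ ∫⁻ x in Icc c d, H x := by
  choose! δ hδ hloc using h
  -- By compactness there is a finite subdivision each of whose pieces lies in one good
  -- neighbourhood; the bounds then add up.
  obtain ⟨t, ht0, htm, ⟨m, hm⟩, hcov⟩ := exists_monotone_Icc_subset_open_cover_Icc hcd
    (c := fun i : Icc c d => {x : Icc c d | dist (x : ℝ) i < δ i})
    (fun i => isOpen_lt (by fun_prop) (by fun_prop))
    (fun x _ => mem_iUnion.2 ⟨x, by simpa using hδ x x.2⟩)
  have key : ∀ n, ‖F c - F (t n)‖ₑ ≤ ∫⁻ x in Icc c (t n : ℝ), H x := by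
    intro n
    induction n with
    | zero => simp [ht0]
    | succ n ih =>
      obtain ⟨i, hi⟩ := hcov n
      have hle : t n ≤ t (n + 1) := htm n.le_succ
      have hstep := hloc i i.2 (t n) (t (n + 1)) hle (t n).2 (t (n + 1)).2
        (hi (left_mem_Icc.2 hle)) (hi (right_mem_Icc.2 hle))
      rw [← setLIntegral_Icc_add_Icc H (t n).2.1 hle]
      calc ‖F c - F (t (n + 1))‖ₑ = ‖(F c - F (t n)) + (F (t n) - F (t (n + 1)))‖ₑ := by ring_nf
        _ ≤ _ := (enorm_add_le _ _).trans (add_le_add ih hstep)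
  have := key m
  rwa [hm m le_rfl] at this

variable [MeasurableSpace X]

/-- Upper gradients can be tested on curves parametrized by arc length. -/
theorem isUpperGradientOn_iff {u : X → ℝ} {g : X → ℝ≥0∞} {U : Set X} :
    IsUpperGradientOn u g U ↔ Measurable g ∧ ∀ (γ : ℝ → X) (c d : ℝ), c ≤ d →
      HasUnitSpeedOn γ (Icc c d) → MapsTo γ (Icc c d) U →
      ‖u (γ c) - u (γ d)‖ₑ ≤ ∫⁻ s in Icc c d, g (γ s) := by
  refine ⟨fun h => ⟨h.1, fun γ c d hcd hγ hU => ?_⟩, fun h => ⟨h.1, fun γ a b hab hc hU hl => ?_⟩⟩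
  · rw [← arcLengthIntegral_of_hasUnitSpeedOn g hcd hγ]
    refine h.2 γ c d hcd (HasUnitSpeedOn.continuousOn hγ) hU ?_
    have := hγ (left_mem_Icc.2 hcd) (right_mem_Icc.2 hcd)
    rw [inter_self] at this
    rw [curveLength, this]
    exact ENNReal.ofReal_lt_top
  · have ha : a ∈ Icc a b := left_mem_Icc.2 hab
    have hbv : BoundedVariationOn γ (Icc a b) := hl.ne
    have hloc := hbv.locallyBoundedVariationOn
    have himg := image_variationOnFromTo_Icc hab hc hl.ne
    have hnat : ∀ t ∈ Icc a b,
        naturalParameterization γ (Icc a b) a (variationOnFromTo γ (Icc a b) a t) = γ t :=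
      fun t ht => edist_eq_zero.1 (edist_naturalParameterization_eq_zero hloc ha ht)
    have hunit := has_unit_speed_naturalParameterization γ hloc ha
    rw [himg] at hunit
    have hmaps : MapsTo (naturalParameterization γ (Icc a b) a)
        (Icc 0 (eVariationOn γ (Icc a b)).toReal) U := by
      intro s hs
      rw [← himg] at hs
      obtain ⟨t, ht, rfl⟩ := hs
      rw [hnat t ht]
      exact hU ht
    have key := h.2 _ 0 _ ENNReal.toReal_nonneg hunit hmaps
    have h0 : naturalParameterization γ (Icc a b) a 0 = γ a := by
      rw [← hnat a ha, variationOnFromTo.self]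
    have h1 : naturalParameterization γ (Icc a b) a (eVariationOn γ (Icc a b)).toReal = γ b := by
      rw [← hnat b (right_mem_Icc.2 hab), variationOnFromTo.eq_of_le _ _ hab, inter_self]
    rwa [h0, h1] at key

theorem IsUpperGradientOn.mono {u : X → ℝ} {g : X → ℝ≥0∞} {U V : Set X}
    (h : IsUpperGradientOn u g U) (hVU : V ⊆ U) : IsUpperGradientOn u g V :=
  ⟨h.1, fun γ a b hab hc hV hl => h.2 γ a b hab hc (hV.mono_right hVU) hl⟩

theorem IsUpperGradientOn.congr {u v : X → ℝ} {g : X → ℝ≥0∞} {U : Set X}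
    (h : IsUpperGradientOn u g U) (huv : EqOn u v U) : IsUpperGradientOn v g U :=
  ⟨h.1, fun γ a b hab hc hU hl => by
    rw [← huv (hU (left_mem_Icc.2 hab)), ← huv (hU (right_mem_Icc.2 hab))]
    exact h.2 γ a b hab hc hU hl⟩

theorem IsUpperGradientOn.mono_gradient {u : X → ℝ} {g G : X → ℝ≥0∞} {U : Set X}
    (h : IsUpperGradientOn u g U) (hG : Measurable G) (hle : ∀ x ∈ U, g x ≤ G x) :
    IsUpperGradientOn u G U := by
  rw [isUpperGradientOn_iff] at h ⊢
  refine ⟨hG, fun γ c d hcd hγ hU => (h.2 γ c d hcd hγ hU).trans ?_⟩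
  exact setLIntegral_mono' measurableSet_Icc fun s hs => hle _ (hU hs)

theorem IsUpperGradientOn.add {u v : X → ℝ} {g h : X → ℝ≥0∞} {U : Set X}
    (hu : IsUpperGradientOn u g U) (hv : IsUpperGradientOn v h U) :
    IsUpperGradientOn (u + v) (g + h) U := by
  refine ⟨hu.1.add hv.1, fun γ a b hab hc hU hl => ?_⟩
  calc ‖(u + v) (γ a) - (u + v) (γ b)‖ₑ
      = ‖(u (γ a) - u (γ b)) + (v (γ a) - v (γ b))‖ₑ := by
        simp only [Pi.add_apply]; ring_nf
    _ ≤ arcLengthIntegral g γ a b + arcLengthIntegral h γ a b :=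
        (enorm_add_le _ _).trans (add_le_add (hu.2 γ a b hab hc hU hl) (hv.2 γ a b hab hc hU hl))
    -- Superadditivity of the lower integral needs no measurability along the curve.
    _ ≤ _ := le_lintegral_add _ _

theorem IsUpperGradientOn.neg {u : X → ℝ} {g : X → ℝ≥0∞} {U : Set X}
    (hu : IsUpperGradientOn u g U) : IsUpperGradientOn (-u) g U :=
  ⟨hu.1, fun γ a b hab hc hU hl => by
    rw [Pi.neg_apply, Pi.neg_apply, neg_sub_neg, ← neg_sub, enorm_neg]
    exact hu.2 γ a b hab hc hU hl⟩

theorem isUpperGradientOn_zero (U : Set X) : IsUpperGradientOn (0 : X → ℝ) 0 U :=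
  ⟨measurable_const, fun γ a b _ _ _ _ => by simp⟩

/-- Continuity pulls the open cover back to the parameter interval, where local increment bounds are
globalized. -/
theorem IsUpperGradientOn.of_local {u : X → ℝ} {g : X → ℝ≥0∞} {U : Set X} (hg : Measurable g)
    (h : ∀ x ∈ U, ∃ V : Set X, IsOpen V ∧ x ∈ V ∧ IsUpperGradientOn u g (U ∩ V)) :
    IsUpperGradientOn u g U := by
  rw [isUpperGradientOn_iff]
  refine ⟨hg, fun γ c d hcd hγ hU => ?_⟩
  refine enorm_sub_le_setLIntegral_of_local (F := u ∘ γ) (H := g ∘ γ) hcd fun t ht => ?_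
  obtain ⟨V, hVo, htV, hV⟩ := h _ (hU ht)
  rw [isUpperGradientOn_iff] at hV
  have hnhds : γ ⁻¹' V ∈ 𝓝[Icc c d] t :=
    HasUnitSpeedOn.continuousOn hγ t ht (hVo.mem_nhds htV)
  obtain ⟨δ, hδ, hsub⟩ := Metric.mem_nhdsWithin_iff.1 hnhds
  refine ⟨δ, hδ, fun s s' hss hs hs' hsδ hsδ' => ?_⟩
  have hI : Icc s s' ⊆ Icc c d := Icc_subset_Icc hs.1 hs'.2
  refine hV.2 γ s s' hss (HasUnitSpeedOn.mono_Icc hγ hI) fun x hx => ⟨hU (hI hx), hsub ⟨?_, hI hx⟩⟩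
  rw [Metric.mem_ball, Real.dist_eq, abs_lt] at *
  constructor <;> linarith [hx.1, hx.2, hsδ.1, hsδ'.2]

/-- The Leibniz rule for upper gradients of convex combinations. -/
theorem IsUpperGradientOn.convexComb {v v' φ : X → ℝ} {g g' h : X → ℝ≥0∞} {U : Set X} {L : ℝ}
    (hv : IsUpperGradientOn v g U) (hv' : IsUpperGradientOn v' g' U)
    (hφ0 : ∀ x, 0 ≤ φ x) (hφ1 : ∀ x, φ x ≤ 1) (hL : 0 ≤ L)
    (hφL : ∀ x y, |φ x - φ y| ≤ L * dist x y) (hh : Measurable h)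
    (hvh : ∀ x ∈ U, ENNReal.ofReal L * ‖v x - v' x‖ₑ ≤ h x) :
    IsUpperGradientOn (fun x => φ x * v x + (1 - φ x) * v' x) (g + g' + h) U := by
  rw [isUpperGradientOn_iff] at hv hv' ⊢
  refine ⟨(hv.1.add hv'.1).add hh, fun γ c d hcd hγ hU => ?_⟩
  set w : X → ℝ := fun x => φ x * v x + (1 - φ x) * v' x with hw
  set l : ℝ≥0∞ := ENNReal.ofReal L with hl
  have hltop : l ≠ ∞ := ENNReal.ofReal_ne_top
  -- On pieces of length at most `ε` the error is a factor `1 + l * ε`, which subdivision preserves;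
  -- then `ε → 0`.
  have key : ∀ ε : ℝ, 0 < ε → ‖w (γ c) - w (γ d)‖ₑ ≤
      (1 + l * ENNReal.ofReal ε) * ∫⁻ s in Icc c d, (g + g' + h) (γ s) := by
    intro ε hε
    have hmulne : (1 + l * ENNReal.ofReal ε) ≠ ∞ := by finiteness
    rw [← lintegral_const_mul' _ _ hmulne]
    refine enorm_sub_le_setLIntegral_of_local (F := w ∘ γ) hcd fun t _ =>
      ⟨ε / 2, half_pos hε, fun s s' hss hs hs' hsδ hsδ' => ?_⟩
    have hIsub : Icc s s' ⊆ Icc c d := Icc_subset_Icc hs.1 hs'.2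
    have hγ' := HasUnitSpeedOn.mono_Icc hγ hIsub
    have hlen : s' - s ≤ ε := by
      rw [Real.dist_eq, abs_lt] at hsδ hsδ'
      linarith
    set A := ∫⁻ x in Icc s s', g (γ x) with hA
    set A' := ∫⁻ x in Icc s s', g' (γ x) with hA'
    set B := ∫⁻ x in Icc s s', h (γ x) with hB
    have hinc : ∀ σ ∈ Icc s s', ‖v (γ s) - v (γ σ)‖ₑ ≤ A ∧ ‖v' (γ s) - v' (γ σ)‖ₑ ≤ A' := by
      intro σ hσ
      have hsub : Icc s σ ⊆ Icc s s' := Icc_subset_Icc_right hσ.2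
      have hu := HasUnitSpeedOn.mono_Icc hγ' hsub
      have hm : MapsTo γ (Icc s σ) U := fun x hx => hU (hIsub (hsub hx))
      exact ⟨(hv.2 γ s σ hσ.1 hu hm).trans (lintegral_mono_set hsub),
        (hv'.2 γ s σ hσ.1 hu hm).trans (lintegral_mono_set hsub)⟩
    -- The value of `v - v'` at the left end is traded for its integral along the piece, since `v`
    -- and `v'` oscillate there by at most `A` and `A'`.
    have hdiff : l * ENNReal.ofReal (s' - s) * ‖v (γ s) - v' (γ s)‖ₑ
        ≤ B + l * ENNReal.ofReal ε * (A + A') := by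
      calc l * ENNReal.ofReal (s' - s) * ‖v (γ s) - v' (γ s)‖ₑ
          = ∫⁻ _ in Icc s s', l * ‖v (γ s) - v' (γ s)‖ₑ := by
            rw [setLIntegral_const, Real.volume_Icc]; ring
        _ ≤ ∫⁻ σ in Icc s s', (h (γ σ) + l * (A + A')) := by
            refine setLIntegral_mono' measurableSet_Icc fun σ hσ => ?_
            obtain ⟨h1, h2⟩ := hinc σ hσ
            calc l * ‖v (γ s) - v' (γ s)‖ₑ
                = l * ‖(v (γ σ) - v' (γ σ)) + ((v (γ s) - v (γ σ)) - (v' (γ s) - v' (γ σ)))‖ₑ := by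
                  congr 2; ring
              _ ≤ l * (‖v (γ σ) - v' (γ σ)‖ₑ + (A + A')) := by
                  gcongr
                  exact (enorm_add_le _ _).trans (add_le_add le_rfl
                    (enorm_sub_le.trans (add_le_add h1 h2)))
              _ ≤ _ := by
                  rw [mul_add]
                  exact add_le_add (hvh _ (hU (hIsub hσ))) le_rfl
        _ = B + l * (A + A') * ENNReal.ofReal (s' - s) := by
            rw [lintegral_add_right _ measurable_const, setLIntegral_const, Real.volume_Icc]
        _ ≤ B + l * (A + A') * ENNReal.ofReal ε := by gcongr
        _ = _ := by ring
    have hs'mem : s' ∈ Icc s s' := right_mem_Icc.2 hss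
    have hφenorm : ∀ x, ‖φ x‖ₑ ≤ 1 ∧ ‖1 - φ x‖ₑ ≤ 1 := by
      intro x
      rw [← ofReal_norm, ← ofReal_norm, ENNReal.ofReal_le_one,
        ENNReal.ofReal_le_one, Real.norm_eq_abs, Real.norm_eq_abs, abs_le, abs_le]
      have := hφ0 x
      have := hφ1 x
      exact ⟨⟨by linarith, by linarith⟩, ⟨by linarith, by linarith⟩⟩
    have hφinc : ‖φ (γ s) - φ (γ s')‖ₑ ≤ l * ENNReal.ofReal (s' - s) := by
      rw [← ofReal_norm, hl, ← ENNReal.ofReal_mul hL]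
      refine ENNReal.ofReal_le_ofReal ((hφL _ _).trans ?_)
      exact mul_le_mul_of_nonneg_left
        (HasUnitSpeedOn.dist_le hγ' (left_mem_Icc.2 hss) hs'mem hss) hL
    calc ‖w (γ s) - w (γ s')‖ₑ
        = ‖φ (γ s') * (v (γ s) - v (γ s')) + (1 - φ (γ s')) * (v' (γ s) - v' (γ s'))
            + (φ (γ s) - φ (γ s')) * (v (γ s) - v' (γ s))‖ₑ := by
          congr 1; simp only [hw]; ring
      _ ≤ 1 * A + 1 * A' + l * ENNReal.ofReal (s' - s) * ‖v (γ s) - v' (γ s)‖ₑ := by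
          refine (enorm_add_le _ _).trans (add_le_add ((enorm_add_le _ _).trans
            (add_le_add ?_ ?_)) ?_) <;> rw [enorm_mul]
          · exact mul_le_mul' (hφenorm _).1 (hinc s' hs'mem).1
          · exact mul_le_mul' (hφenorm _).2 (hinc s' hs'mem).2
          · exact mul_le_mul' hφinc le_rfl
      _ ≤ 1 * A + 1 * A' + (B + l * ENNReal.ofReal ε * (A + A')) := by gcongr
      _ ≤ (1 + l * ENNReal.ofReal ε) * (A + A' + B) := by
          have : (1 + l * ENNReal.ofReal ε) * (A + A' + B) =
              1 * A + 1 * A' + (B + l * ENNReal.ofReal ε * (A + A'))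
                + l * ENNReal.ofReal ε * B := by ring
          rw [this]
          exact le_self_add
      _ ≤ (1 + l * ENNReal.ofReal ε) * ∫⁻ x in Icc s s', (g + g' + h) (γ x) := by
          gcongr
          exact (add_le_add (le_lintegral_add _ _) le_rfl).trans (le_lintegral_add _ _)
      _ = _ := (lintegral_const_mul' _ _ hmulne).symm
  have hlim : Tendsto (fun ε : ℝ => (1 + l * ENNReal.ofReal ε) *
      ∫⁻ s in Icc c d, (g + g' + h) (γ s)) (𝓝[>] 0)
      (𝓝 ((1 + l * ENNReal.ofReal 0) * ∫⁻ s in Icc c d, (g + g' + h) (γ s))) := by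
    refine Tendsto.mono_left ?_ nhdsWithin_le_nhds
    refine ENNReal.Tendsto.mul_const ?_ (Or.inl (by simp))
    refine tendsto_const_nhds.add (ENNReal.Tendsto.const_mul ?_ (Or.inr hltop))
    exact (ENNReal.continuous_ofReal.tendsto 0)
  have := ge_of_tendsto hlim (by filter_upwards [self_mem_nhdsWithin] with ε hε using key ε hε)
  simpa using this

end Curves

/-! ### Auxiliary facts on extended nonnegative reals and integrals -/

theorem le_add_of_forall_lt_of_ne_top {x y z : ℝ≥0∞}
    (h : ∀ a b, x < a → y < b → a ≠ ∞ → b ≠ ∞ → z ≤ a + b) : z ≤ x + y := by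
  by_cases hx : x = ∞
  · simp [hx]
  by_cases hy : y = ∞
  · simp [hy]
  refine ENNReal.le_of_forall_pos_le_add fun ε hε _ => ?_
  have hε2 : ((ε / 2 : ℝ≥0) : ℝ≥0∞) ≠ 0 := by simpa using (half_pos hε).ne'
  have key := h (x + (ε / 2 : ℝ≥0)) (y + (ε / 2 : ℝ≥0)) (ENNReal.lt_add_right hx hε2)
    (ENNReal.lt_add_right hy hε2) (by finiteness) (by finiteness)
  calc z ≤ x + (ε / 2 : ℝ≥0) + (y + (ε / 2 : ℝ≥0)) := key
    _ = x + y + ((ε / 2 : ℝ≥0) + (ε / 2 : ℝ≥0)) := by ring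
    _ = x + y + ε := by rw [← ENNReal.coe_add, add_halves]

theorem liminf_add_liminf_le {f g : ℕ → ℝ≥0∞} :
    liminf f atTop + liminf g atTop ≤ liminf (fun i => f i + g i) atTop := by
  simp only [liminf_eq_iSup_iInf_of_nat]
  rw [ENNReal.iSup_add_iSup_of_monotone]
  · exact iSup_mono fun n => le_iInf₂ fun i hi => add_le_add (iInf₂_le i hi) (iInf₂_le i hi)
  all_goals exact fun m n hmn => le_iInf₂ fun i hi => iInf₂_le i (hmn.trans hi)

/-- Set the measurable representative to `∞` on a measurable null set containing all disagreement
points. The bound must hold everywhere because upper gradients are tested on curves, which null sets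
can contain. -/
theorem exists_measurable_ge_setLIntegral_eq {α : Type*} [MeasurableSpace α] {μ : Measure α}
    {f : α → ℝ≥0∞} (hf : AEMeasurable f μ) :
    ∃ h : α → ℝ≥0∞, Measurable h ∧ f ≤ h ∧ ∫⁻ x, h x ∂μ = ∫⁻ x, f x ∂μ := by
  classical
  set N := toMeasurable μ {x | f x ≠ hf.mk f x} with hN
  have hN0 : μ N = 0 := by rw [measure_toMeasurable]; exact hf.ae_eq_mk
  have hNm : MeasurableSet N := measurableSet_toMeasurable _ _
  refine ⟨N.piecewise (fun _ => ∞) (hf.mk f), measurable_const.piecewise hNm hf.measurable_mk,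
    fun x => ?_, lintegral_congr_ae ?_⟩
  · by_cases hx : x ∈ N
    · simp [hx]
    · rw [piecewise_eq_of_notMem _ _ _ hx]
      have : x ∉ {x | f x ≠ hf.mk f x} := fun h => hx (subset_toMeasurable _ _ h)
      exact (not_not.1 this).le
  · have : ∀ᵐ x ∂μ, x ∉ N := measure_eq_zero_iff_ae_notMem.1 hN0
    filter_upwards [this, hf.ae_eq_mk] with x hx hx'
    rw [piecewise_eq_of_notMem _ _ _ hx, hx']

theorem setLIntegral_enorm_sub_le {α : Type*} [MeasurableSpace α] {μ : Measure α} {S : Set α}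
    {u v w : α → ℝ}
    (huv : AEStronglyMeasurable (fun x => u x - v x) (μ.restrict S)) :
    ∫⁻ x in S, ‖u x - w x‖ₑ ∂μ ≤
      (∫⁻ x in S, ‖u x - v x‖ₑ ∂μ) + ∫⁻ x in S, ‖v x - w x‖ₑ ∂μ := by
  rw [← lintegral_add_left' huv.enorm]
  refine lintegral_mono fun x => ?_
  calc ‖u x - w x‖ₑ = ‖(u x - v x) + (v x - w x)‖ₑ := by ring_nf
    _ ≤ _ := enorm_add_le _ _

/-! ### Total variation: approximation, subadditivity, semicontinuity -/

section Variation

variable {X : Type*} [MetricSpace X]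

theorem CompactlyInside.mono {V U U' : Set X} (h : CompactlyInside V U) (hU : U ⊆ U') :
    CompactlyInside V U' :=
  ⟨h.1, h.2.1, h.2.2.trans hU⟩

theorem CompactlyInside.subset {V U : Set X} (h : CompactlyInside V U) : V ⊆ U :=
  subset_closure.trans h.2.2

/-- Lets local L¹ convergence be tested along one sequence of sets, so that a diagonal choice of
approximants is possible. -/
theorem exists_seq_compactlyInside [ProperSpace X] {U : Set X} (hU : IsOpen U) :
    ∃ V : ℕ → Set X, (∀ n, CompactlyInside (V n) U) ∧
      ∀ W, CompactlyInside W U → ∃ n, ∀ m, n ≤ m → W ⊆ V m := by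
  have : LocallyCompactSpace U := hU.locallyCompactSpace
  let K : CompactExhaustion U := default
  refine ⟨fun n => Subtype.val '' interior (K n), fun n => ?_, fun W hW => ?_⟩
  · have hc : IsCompact (Subtype.val '' K n) := (K.isCompact n).image continuous_subtype_val
    have hsub : closure (Subtype.val '' interior (K n)) ⊆ Subtype.val '' K n :=
      closure_minimal (image_mono interior_subset) hc.isClosed
    refine ⟨hU.isOpenMap_subtype_val _ isOpen_interior, hc.of_isClosed_subset isClosed_closure hsub,
      hsub.trans ?_⟩
    rintro _ ⟨x, _, rfl⟩
    exact x.2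
  · have himg : Subtype.val '' (Subtype.val ⁻¹' closure W : Set U) = closure W := by
      rw [Subtype.image_preimage_coe, inter_eq_right.2 hW.2.2]
    have hc : IsCompact (Subtype.val ⁻¹' closure W : Set U) := by
      rw [Subtype.isCompact_iff, himg]
      exact hW.2.1
    obtain ⟨n, hn⟩ := K.exists_superset_of_isCompact hc
    refine ⟨n + 1, fun m hm => ?_⟩
    calc W ⊆ closure W := subset_closure
      _ = Subtype.val '' (Subtype.val ⁻¹' closure W : Set U) := himg.symm
      _ ⊆ Subtype.val '' interior (K m) := by
        refine image_mono (hn.trans ((K.subset_interior_succ n).trans (interior_mono ?_)))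
        exact K.subset hm

variable [MeasurableSpace X] {μ : Measure X}

theorem MemNewtonianLoc.mono {u : X → ℝ} {U V : Set X} (h : MemNewtonianLoc μ u U) (hVU : V ⊆ U) :
    MemNewtonianLoc μ u V :=
  fun W hW => h W (hW.mono hVU)

theorem TendstoL1Loc.mono {v : ℕ → X → ℝ} {u : X → ℝ} {U V : Set X} (h : TendstoL1Loc μ v u U)
    (hVU : V ⊆ U) : TendstoL1Loc μ v u V :=
  fun W hW => h W (hW.mono hVU)

theorem memNewtonianLoc_of_integrableOn {u : X → ℝ} {g : X → ℝ≥0∞} {U : Set X}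
    (hu : ∀ V, CompactlyInside V U → IntegrableOn u V μ) (hg : IsUpperGradientOn u g U)
    (hfin : ∫⁻ x in U, g x ∂μ < ∞) : MemNewtonianLoc μ u U :=
  fun V hV => ⟨hu V hV, g, hg.mono hV.subset, (lintegral_mono_set hV.subset).trans_lt hfin⟩

theorem variationOpen_le_liminf {u : X → ℝ} {U : Set X} {v : ℕ → X → ℝ} {g : ℕ → X → ℝ≥0∞}
    (hv : ∀ i, MemNewtonianLoc μ (v i) U) (hg : ∀ i, IsUpperGradientOn (v i) (g i) U)
    (hlim : TendstoL1Loc μ v u U) :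
    variationOpen μ u U ≤ liminf (fun i => ∫⁻ x in U, g i x ∂μ) atTop :=
  iInf_le_of_le v <| iInf_le_of_le g <| iInf_le_of_le hv <| iInf_le_of_le hg <|
    iInf_le_of_le hlim le_rfl

/-- Approximation with arbitrarily small error on compactly contained sets suffices to bound the
total variation. -/
theorem variationOpen_le_of_approx [ProperSpace X] {u : X → ℝ} {U : Set X} (hU : IsOpen U)
    {M : ℝ≥0∞}
    (h : ∀ (ε : ℝ≥0∞) (V : Set X), ε ≠ 0 → ε ≠ ∞ → CompactlyInside V U →
      ∃ (v : X → ℝ) (g : X → ℝ≥0∞), MemNewtonianLoc μ v U ∧ IsUpperGradientOn v g U ∧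
        ∫⁻ x in V, ‖v x - u x‖ₑ ∂μ ≤ ε ∧ ∫⁻ x in U, g x ∂μ ≤ M + ε) :
    variationOpen μ u U ≤ M := by
  obtain ⟨V, hV, hex⟩ := exists_seq_compactlyInside hU
  have hε0 : ∀ n : ℕ, ((n + 1 : ℕ) : ℝ≥0∞)⁻¹ ≠ 0 := fun n => by simp
  have hεt : ∀ n : ℕ, ((n + 1 : ℕ) : ℝ≥0∞)⁻¹ ≠ ∞ := fun n => by
    rw [Ne, ENNReal.inv_eq_top]; exact_mod_cast n.succ_ne_zero
  choose v g hv hg hvu hgM using fun n : ℕ => h _ (V n) (hε0 n) (hεt n) (hV n)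
  have hεlim : Tendsto (fun n : ℕ => ((n + 1 : ℕ) : ℝ≥0∞)⁻¹) atTop (𝓝 0) :=
    ENNReal.tendsto_inv_nat_nhds_zero.comp (tendsto_add_atTop_nat 1)
  refine (variationOpen_le_liminf hv hg fun W hW => ?_).trans ?_
  · obtain ⟨n, hn⟩ := hex W hW
    refine tendsto_of_tendsto_of_tendsto_of_le_of_le' tendsto_const_nhds hεlim
      (Eventually.of_forall fun _ => zero_le) ?_
    filter_upwards [eventually_ge_atTop n] with m hm
    exact (lintegral_mono_set (hn m hm)).trans (hvu m)
  · have hlim : Tendsto (fun n : ℕ => M + ((n + 1 : ℕ) : ℝ≥0∞)⁻¹) atTop (𝓝 (M + 0)) :=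
      tendsto_const_nhds.add hεlim
    calc liminf (fun i => ∫⁻ x in U, g i x ∂μ) atTop
        ≤ liminf (fun n : ℕ => M + ((n + 1 : ℕ) : ℝ≥0∞)⁻¹) atTop :=
          liminf_le_liminf (Eventually.of_forall hgM)
      _ = M := by rw [hlim.liminf_eq, add_zero]

/-- The energy bound holds infinitely often along a near-optimal sequence and the L¹ bound
eventually, so one term satisfies both. -/
theorem exists_approx_of_variationOpen_lt {u : X → ℝ} {U : Set X} {M : ℝ≥0∞}
    (h : variationOpen μ u U < M) {ε : ℝ≥0∞} (hε : ε ≠ 0) {V : Set X} (hV : CompactlyInside V U) :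
    ∃ (v : X → ℝ) (g : X → ℝ≥0∞), MemNewtonianLoc μ v U ∧ IsUpperGradientOn v g U ∧
      ∫⁻ x in V, ‖v x - u x‖ₑ ∂μ ≤ ε ∧ ∫⁻ x in U, g x ∂μ < M := by
  simp only [variationOpen, iInf_lt_iff] at h
  obtain ⟨v, g, hv, hg, hlim, hlt⟩ := h
  have h1 := frequently_lt_of_liminf_lt (by isBoundedDefault) hlt
  have h2 : ∀ᶠ i in atTop, ∫⁻ x in V, ‖v i x - u x‖ₑ ∂μ ≤ ε :=
    (hlim V hV).eventually (Iic_mem_nhds (pos_iff_ne_zero.2 hε))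
  obtain ⟨i, hi1, hi2⟩ := (h1.and_eventually h2).exists
  exact ⟨v i, g i, hv i, hg i, hi2, hi1⟩

theorem variationOpen_mono (u : X → ℝ) {U V : Set X} (hVU : V ⊆ U) :
    variationOpen μ u V ≤ variationOpen μ u U :=
  le_iInf fun _ => le_iInf fun _ => le_iInf fun hv => le_iInf fun hg => le_iInf fun hlim =>
    (variationOpen_le_liminf (fun i => (hv i).mono hVU) (fun i => (hg i).mono hVU)
      (hlim.mono hVU)).trans
      (liminf_le_liminf (Eventually.of_forall fun _ => lintegral_mono_set hVU))

theorem variationOpen_congr_le {u u' : X → ℝ} {U : Set X}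
    (h : ∀ᵐ x ∂μ.restrict U, u x = u' x) : variationOpen μ u U ≤ variationOpen μ u' U := by
  refine le_iInf fun v => le_iInf fun _ => le_iInf fun hv => le_iInf fun hg => le_iInf fun hlim =>
    variationOpen_le_liminf hv hg fun V hV => ?_
  have h' := ae_restrict_of_ae_restrict_of_subset hV.subset h
  refine (hlim V hV).congr fun i => lintegral_congr_ae ?_
  filter_upwards [h'] with x hx
  rw [hx]

theorem variationOpen_zero (U : Set X) : variationOpen μ (0 : X → ℝ) U = 0 := by
  have h0 : MemNewtonianLoc μ (0 : X → ℝ) U :=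
    memNewtonianLoc_of_integrableOn (fun _ _ => integrableOn_zero) (isUpperGradientOn_zero U)
      (by simp)
  have := variationOpen_le_liminf (μ := μ) (u := 0) (v := fun _ => 0) (g := fun _ => 0)
    (fun _ => h0) (fun _ => isUpperGradientOn_zero U) (fun V _ => by simp [TendstoL1])
  simpa using this

theorem variationOpen_neg (u : X → ℝ) (U : Set X) :
    variationOpen μ (-u) U = variationOpen μ u U := by
  have key : ∀ w : X → ℝ, variationOpen μ (-w) U ≤ variationOpen μ w U := by
    intro w
    refine le_iInf fun v => le_iInf fun g => le_iInf fun hv => le_iInf fun hg => le_iInf fun hlim =>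
      variationOpen_le_liminf (v := fun i => -v i) (fun i V hV => ?_) (fun i => (hg i).neg)
        fun V hV => ?_
    · obtain ⟨hi, k, hk, hfin⟩ := hv i V hV
      exact ⟨hi.neg, k, hk.neg, hfin⟩
    · refine (hlim V hV).congr fun i => lintegral_congr fun x => ?_
      simp only [Pi.neg_apply]
      rw [neg_sub_neg, ← neg_sub, enorm_neg]
  refine le_antisymm (key u) ?_
  simpa using key (-u)

/-- A sequence admissible on `W` restricts to both parts, and the lower limit is superadditive. -/
theorem variationOpen_add_disjoint [OpensMeasurableSpace X] (u : X → ℝ) {U V W : Set X}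
    (hV : IsOpen V) (hd : Disjoint U V) (hU : U ⊆ W) (hVW : V ⊆ W) :
    variationOpen μ u U + variationOpen μ u V ≤ variationOpen μ u W := by
  refine le_iInf fun v => le_iInf fun g => le_iInf fun hv => le_iInf fun hg => le_iInf fun hlim => ?_
  calc variationOpen μ u U + variationOpen μ u V
      ≤ liminf (fun i => ∫⁻ x in U, g i x ∂μ) atTop + liminf (fun i => ∫⁻ x in V, g i x ∂μ) atTop :=
        add_le_add
          (variationOpen_le_liminf (fun i => (hv i).mono hU) (fun i => (hg i).mono hU) (hlim.mono hU))
          (variationOpen_le_liminf (fun i => (hv i).mono hVW) (fun i => (hg i).mono hVW)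
            (hlim.mono hVW))
    _ ≤ liminf (fun i => (∫⁻ x in U, g i x ∂μ) + ∫⁻ x in V, g i x ∂μ) atTop := liminf_add_liminf_le
    _ ≤ _ := by
      refine liminf_le_liminf (Eventually.of_forall fun i => ?_)
      rw [← lintegral_union hV.measurableSet hd]
      exact lintegral_mono_set (union_subset hU hVW)

theorem variationOpen_add_le [ProperSpace X] (u v : X → ℝ) {U : Set X} (hU : IsOpen U)
    (hum : AEStronglyMeasurable u μ) :
    variationOpen μ (u + v) U ≤ variationOpen μ u U + variationOpen μ v U := by
  refine le_add_of_forall_lt_of_ne_top fun a b ha hb ha' hb' => ?_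
  refine variationOpen_le_of_approx hU fun ε V hε hε' hV => ?_
  have hε2 : ε / 2 ≠ 0 := (ENNReal.half_pos hε).ne'
  obtain ⟨w, g, hw, hg, hwu, hga⟩ := exists_approx_of_variationOpen_lt ha hε2 hV
  obtain ⟨w', g', hw', hg', hwu', hga'⟩ := exists_approx_of_variationOpen_lt hb hε2 hV
  have hsum : ∫⁻ x in U, (g + g') x ∂μ ≤ a + b := by
    rw [show (fun x => (g + g') x) = fun x => g x + g' x from rfl, lintegral_add_left hg.1]
    exact add_le_add hga.le hga'.le
  refine ⟨w + w', g + g', memNewtonianLoc_of_integrableOn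
    (fun W hW => ((hw W hW).1.add (hw' W hW).1)) (hg.add hg')
    (hsum.trans_lt (by finiteness)), hg.add hg', ?_, hsum.trans le_self_add⟩
  have hm : AEMeasurable (fun x => ‖w x - u x‖ₑ) (μ.restrict V) :=
    ((hw V hV).1.aestronglyMeasurable.sub hum.restrict).enorm
  calc ∫⁻ x in V, ‖(w + w') x - (u + v) x‖ₑ ∂μ
      ≤ ∫⁻ x in V, (‖w x - u x‖ₑ + ‖w' x - v x‖ₑ) ∂μ := by
        refine lintegral_mono fun x => ?_
        calc ‖(w + w') x - (u + v) x‖ₑ = ‖(w x - u x) + (w' x - v x)‖ₑ := by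
              simp only [Pi.add_apply]; ring_nf
          _ ≤ _ := enorm_add_le _ _
    _ = (∫⁻ x in V, ‖w x - u x‖ₑ ∂μ) + ∫⁻ x in V, ‖w' x - v x‖ₑ ∂μ := lintegral_add_left' hm _
    _ ≤ ε / 2 + ε / 2 := add_le_add hwu hwu'
    _ = ε := ENNReal.add_halves ε

/-- Lower semicontinuity of the total variation in open sets. -/
theorem variationOpen_le_of_tendsto [ProperSpace X] {w : ℕ → X → ℝ} {u : X → ℝ} {U : Set X}
    (hU : IsOpen U) {M : ℝ≥0∞} (hwm : ∀ k, AEStronglyMeasurable (w k) μ)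
    (hlim : TendstoL1Loc μ w u U) (hM : ∃ᶠ k in atTop, variationOpen μ (w k) U ≤ M) :
    variationOpen μ u U ≤ M := by
  by_cases hMt : M = ∞
  · simp [hMt]
  refine variationOpen_le_of_approx hU fun ε V hε hε' hV => ?_
  have hε2 : ε / 2 ≠ 0 := (ENNReal.half_pos hε).ne'
  obtain ⟨k, hk, hkε⟩ := (hM.and_eventually
    ((hlim V hV).eventually (Iic_mem_nhds (pos_iff_ne_zero.2 hε2)))).exists
  obtain ⟨v, g, hv, hg, hvw, hgM⟩ := exists_approx_of_variationOpen_lt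
    (hk.trans_lt (ENNReal.lt_add_right hMt hε)) hε2 hV
  refine ⟨v, g, hv, hg, ?_, hgM.le⟩
  calc ∫⁻ x in V, ‖v x - u x‖ₑ ∂μ
      ≤ (∫⁻ x in V, ‖v x - w k x‖ₑ ∂μ) + ∫⁻ x in V, ‖w k x - u x‖ₑ ∂μ :=
        setLIntegral_enorm_sub_le ((hv V hV).1.aestronglyMeasurable.sub (hwm k).restrict)
    _ ≤ ε / 2 + ε / 2 := add_le_add hvw hkε
    _ = ε := ENNReal.add_halves ε

theorem variation_of_isOpen (u : X → ℝ) {U : Set X} (hU : IsOpen U) :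
    variation μ u U = variationOpen μ u U :=
  le_antisymm (iInf_le_of_le U <| iInf_le_of_le hU <| iInf_le_of_le Subset.rfl le_rfl)
    (le_iInf fun _ => le_iInf fun _ => le_iInf fun h => variationOpen_mono u h)

theorem variation_le_variationOpen (u : X → ℝ) {A U : Set X} (hU : IsOpen U) (hAU : A ⊆ U) :
    variation μ u A ≤ variationOpen μ u U :=
  iInf_le_of_le U <| iInf_le_of_le hU <| iInf_le_of_le hAU le_rfl

theorem exists_isOpen_variationOpen_lt {u : X → ℝ} {A : Set X} {M : ℝ≥0∞}
    (h : variation μ u A < M) : ∃ U, IsOpen U ∧ A ⊆ U ∧ variationOpen μ u U < M := by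
  simpa only [variation, iInf_lt_iff, exists_prop] using h

theorem variation_mono (u : X → ℝ) {A B : Set X} (h : A ⊆ B) : variation μ u A ≤ variation μ u B :=
  le_iInf fun _ => le_iInf fun hU => le_iInf fun hB => variation_le_variationOpen u hU (h.trans hB)

theorem variation_neg (u : X → ℝ) (A : Set X) : variation μ (-u) A = variation μ u A := by
  simp only [variation, variationOpen_neg]

theorem variation_add_le [ProperSpace X] (u v : X → ℝ) (A : Set X)
    (hum : AEStronglyMeasurable u μ) :
    variation μ (u + v) A ≤ variation μ u A + variation μ v A := by
  refine le_add_of_forall_lt_of_ne_top fun a b ha hb _ _ => ?_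
  obtain ⟨U, hU, hAU, hUa⟩ := exists_isOpen_variationOpen_lt ha
  obtain ⟨V, hV, hAV, hVb⟩ := exists_isOpen_variationOpen_lt hb
  calc variation μ (u + v) A ≤ variationOpen μ (u + v) (U ∩ V) :=
        variation_le_variationOpen _ (hU.inter hV) (subset_inter hAU hAV)
    _ ≤ variationOpen μ u (U ∩ V) + variationOpen μ v (U ∩ V) :=
        variationOpen_add_le u v (hU.inter hV) hum
    _ ≤ a + b := add_le_add ((variationOpen_mono u inter_subset_left).trans hUa.le)
        ((variationOpen_mono v inter_subset_right).trans hVb.le)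

theorem variation_sub_le [ProperSpace X] (u v : X → ℝ) (A : Set X)
    (hum : AEStronglyMeasurable u μ) :
    variation μ (u - v) A ≤ variation μ u A + variation μ v A := by
  rw [sub_eq_add_neg, ← variation_neg v]
  exact variation_add_le u (-v) A hum

theorem MemBV.add [ProperSpace X] {u v : X → ℝ} (hu : MemBV μ u) (hv : MemBV μ v) :
    MemBV μ (u + v) :=
  ⟨hu.1.add hv.1, (variation_add_le u v univ hu.1.aestronglyMeasurable).trans_lt
    (ENNReal.add_lt_top.2 ⟨hu.2, hv.2⟩)⟩

theorem MemBV.sub [ProperSpace X] {u v : X → ℝ} (hu : MemBV μ u) (hv : MemBV μ v) :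
    MemBV μ (u - v) :=
  ⟨hu.1.sub hv.1, (variation_sub_le u v univ hu.1.aestronglyMeasurable).trans_lt
    (ENNReal.add_lt_top.2 ⟨hu.2, hv.2⟩)⟩

end Variation

/-! ### Lipschitz cutoff functions -/

section Cutoff

variable {X : Type*}

/-- The cutoff which is `1` on `{ρ ≤ a}` and `0` on `{b ≤ ρ}`. -/
noncomputable def rampCutoff (ρ : X → ℝ) (a b : ℝ) (x : X) : ℝ :=
  max (min ((b - ρ x) / (b - a)) 1) 0

theorem rampCutoff_nonneg (ρ : X → ℝ) (a b : ℝ) (x : X) : 0 ≤ rampCutoff ρ a b x :=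
  le_max_right _ _

theorem rampCutoff_le_one (ρ : X → ℝ) (a b : ℝ) (x : X) : rampCutoff ρ a b x ≤ 1 :=
  max_le (min_le_right _ _) zero_le_one

theorem rampCutoff_eq_one {ρ : X → ℝ} {a b : ℝ} (hab : a < b) {x : X} (hx : ρ x ≤ a) :
    rampCutoff ρ a b x = 1 := by
  rw [rampCutoff, min_eq_right, max_eq_left zero_le_one]
  rw [one_le_div (sub_pos.2 hab)]
  linarith

theorem rampCutoff_eq_zero {ρ : X → ℝ} {a b : ℝ} (hab : a < b) {x : X} (hx : b ≤ ρ x) :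
    rampCutoff ρ a b x = 0 := by
  rw [rampCutoff, max_eq_right]
  exact (min_le_left _ _).trans
    (div_nonpos_of_nonpos_of_nonneg (by linarith) (sub_nonneg.2 hab.le))

theorem abs_rampCutoff_sub_le [PseudoMetricSpace X] {ρ : X → ℝ} (hρ : LipschitzWith 1 ρ) {a b : ℝ} (hab : a < b)
    (x y : X) : |rampCutoff ρ a b x - rampCutoff ρ a b y| ≤ (b - a)⁻¹ * dist x y := by
  have hba : 0 < b - a := sub_pos.2 hab
  calc |rampCutoff ρ a b x - rampCutoff ρ a b y|
      ≤ |min ((b - ρ x) / (b - a)) 1 - min ((b - ρ y) / (b - a)) 1| := abs_max_sub_max_le_abs _ _ _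
    _ ≤ max |(b - ρ x) / (b - a) - (b - ρ y) / (b - a)| |(1 : ℝ) - 1| :=
        abs_min_sub_min_le_max _ _ _ _
    _ = (b - a)⁻¹ * |ρ x - ρ y| := by
        rw [sub_self, abs_zero, max_eq_left (abs_nonneg _), ← sub_div, abs_div, abs_of_pos hba,
          sub_sub_sub_cancel_left, abs_sub_comm, div_eq_inv_mul]
    _ ≤ (b - a)⁻¹ * dist x y := by
        gcongr
        simpa [Real.dist_eq] using hρ.dist_le_mul x y

theorem enorm_rampCutoff_le (ρ : X → ℝ) (a b : ℝ) (x : X) : ‖rampCutoff ρ a b x‖ₑ ≤ 1 := by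
  rw [← ofReal_norm, ENNReal.ofReal_le_one, Real.norm_of_nonneg (rampCutoff_nonneg ρ a b x)]
  exact rampCutoff_le_one ρ a b x

theorem enorm_one_sub_rampCutoff_le (ρ : X → ℝ) (a b : ℝ) (x : X) :
    ‖1 - rampCutoff ρ a b x‖ₑ ≤ 1 := by
  rw [← ofReal_norm, ENNReal.ofReal_le_one,
    Real.norm_of_nonneg (sub_nonneg.2 (rampCutoff_le_one ρ a b x))]
  linarith [rampCutoff_nonneg ρ a b x]

/-- The pointwise comparison of a glued function with the functions it is glued from. -/
theorem enorm_ramp_comb_le {ρ v v' : X → ℝ} {a b a' b' : ℝ} (hab : a < b) (ha : a' < a)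
    (hb : b < b') (x : X) :
    ‖rampCutoff ρ a b x * v x + (1 - rampCutoff ρ a b x) * v' x‖ₑ ≤
      {x | ρ x < b'}.indicator (fun x => ‖v x‖ₑ) x + {x | a' < ρ x}.indicator (fun x => ‖v' x‖ₑ) x := by
  refine (enorm_add_le _ _).trans (add_le_add ?_ ?_) <;> rw [enorm_mul]
  · by_cases hx : ρ x < b'
    · rw [indicator_of_mem (by exact hx)]
      exact mul_le_of_le_one_left' (enorm_rampCutoff_le ρ a b x)
    · rw [rampCutoff_eq_zero hab (hb.le.trans (not_lt.1 hx))]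
      simp
  · by_cases hx : a' < ρ x
    · rw [indicator_of_mem (by exact hx)]
      exact mul_le_of_le_one_left' (enorm_one_sub_rampCutoff_le ρ a b x)
    · rw [rampCutoff_eq_one hab ((not_lt.1 hx).trans ha.le)]
      simp

end Cutoff

/-! ### Gluing across collars and variation on compact sets -/

section Gluing

variable {X : Type*} [MetricSpace X]

/-- A compact set is the zero sublevel of a Lipschitz function with compact sublevels. -/
theorem exists_lipschitz_gauge [ProperSpace X] {K : Set X} (hK : IsCompact K) :
    ∃ ρ : X → ℝ, LipschitzWith 1 ρ ∧ (∀ t, IsCompact {x | ρ x ≤ t}) ∧ K = {x | ρ x ≤ 0} := by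
  rcases K.eq_empty_or_nonempty with rfl | hne
  · rcases isEmpty_or_nonempty X with hX | ⟨⟨p⟩⟩
    · exact ⟨fun _ => 1, LipschitzWith.const' 1, fun t => by simp [eq_empty_of_isEmpty],
        (eq_empty_of_isEmpty _).symm⟩
    · refine ⟨fun x => dist x p + 1, ?_, fun t => ?_, ?_⟩
      · exact LipschitzWith.of_dist_le_mul fun x y => by
          simpa [Real.dist_eq] using abs_dist_sub_le x y p
      · convert isCompact_closedBall p (t - 1) using 1
        ext x
        simp [le_sub_iff_add_le]
      · symm
        rw [eq_empty_iff_forall_notMem]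
        intro x hx
        have : dist x p + 1 ≤ 0 := hx
        linarith [dist_nonneg (x := x) (y := p)]
  · refine ⟨fun x => Metric.infDist x K, Metric.lipschitz_infDist_pt K, fun t => ?_, ?_⟩
    · refine Metric.isCompact_of_isClosed_isBounded
        (isClosed_le (Metric.continuous_infDist_pt K) continuous_const) ?_
      refine (hK.isBounded.cthickening (δ := t)).subset fun x hx => ?_
      rw [Metric.mem_cthickening_iff]
      rw [← ENNReal.ofReal_toReal (Metric.infEDist_ne_top hne)]
      exact ENNReal.ofReal_le_ofReal hx
    · ext x
      rw [hK.isClosed.mem_iff_infDist_zero hne, mem_ofPred_eq]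
      exact ⟨fun h => h.le, fun h => le_antisymm h Metric.infDist_nonneg⟩

/-- On the compact set `{ρ ≤ 1} \ U` the function `ρ` attains its minimum, which is positive. -/
theorem exists_sublevel_subset {ρ : X → ℝ} (hρc : Continuous ρ)
    (hcomp : ∀ t, IsCompact {x | ρ x ≤ t}) {U : Set X} (hU : IsOpen U) (h : {x | ρ x ≤ 0} ⊆ U) :
    ∃ s > 0, {x | ρ x < s} ⊆ U := by
  rcases ({x | ρ x ≤ 1} \ U).eq_empty_or_nonempty with he | hne
  · exact ⟨1, one_pos, fun x hx => sdiff_eq_empty.1 he (le_of_lt hx : ρ x ≤ 1)⟩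
  · obtain ⟨z, hz, hmin⟩ := ((hcomp 1).diff hU).exists_isMinOn hne hρc.continuousOn
    refine ⟨min 1 (ρ z), lt_min one_pos (not_le.1 fun h0 => hz.2 (h h0)), fun x hx => ?_⟩
    by_contra hxU
    have hx' : ρ x < min 1 (ρ z) := hx
    exact absurd (hmin ⟨(hx'.trans_le (min_le_left _ _)).le, hxU⟩)
      (not_le.2 (hx'.trans_le (min_le_right _ _)))

variable [MeasurableSpace X] {μ : Measure X}

/-- Gluing along a compact collar: subadditivity of the total variation for two overlapping
open sets. -/
theorem variationOpen_le_add_of_collar [BorelSpace X] [ProperSpace X] {U : Set X} (hU : IsOpen U)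
    {ρ : X → ℝ} (hρ : LipschitzWith 1 ρ) {r s : ℝ} (hrs : r < s)
    (hcomp : ∀ t, IsCompact {x | ρ x ≤ t}) (hsU : {x | ρ x < s} ⊆ U) {u : X → ℝ}
    (hum : AEStronglyMeasurable u μ) :
    variationOpen μ u U ≤
      variationOpen μ u {x | ρ x < s} + variationOpen μ u (U ∩ {x | r < ρ x}) := by
  have hρc : Continuous ρ := hρ.continuous
  refine le_add_of_forall_lt_of_ne_top fun M₁ M₂ h₁ h₂ hM₁ hM₂ => ?_
  -- The levels satisfy `r < a' < a < b < b' < s`: the cutoff varies on `[a, b]`, and the margins up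
  -- to `a'` and `b'` make the transition zone open.
  obtain ⟨a', hra', ha's⟩ := exists_between hrs
  obtain ⟨b', ha'b', hb's⟩ := exists_between ha's
  obtain ⟨a, ha'a, hab'⟩ := exists_between ha'b'
  obtain ⟨b, hab, hbb'⟩ := exists_between hab'
  set l : ℝ≥0∞ := ENNReal.ofReal (b - a)⁻¹ with hl
  refine variationOpen_le_of_approx hU fun ε V hε hε' hV => ?_
  have hclb' : closure {x | ρ x < b'} ⊆ {x | ρ x ≤ b'} :=
    closure_minimal (fun x hx => (le_of_lt hx : ρ x ≤ b')) (isClosed_le hρc continuous_const)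
  have hcla' : closure {x | a' < ρ x} ⊆ {x | a' ≤ ρ x} :=
    closure_minimal (fun x hx => (le_of_lt hx : a' ≤ ρ x)) (isClosed_le continuous_const hρc)
  have hob' : IsOpen {x | ρ x < b'} := isOpen_lt hρc continuous_const
  have hoa' : IsOpen {x | a' < ρ x} := isOpen_lt continuous_const hρc
  have hV₁ : CompactlyInside {x | ρ x < b'} {x | ρ x < s} :=
    ⟨hob', (hcomp b').of_isClosed_subset isClosed_closure hclb',
      fun x hx => lt_of_le_of_lt (hclb' hx) hb's⟩
  have hV₂ : ∀ W, CompactlyInside W U →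
      CompactlyInside (W ∩ {x | a' < ρ x}) (U ∩ {x | r < ρ x}) := fun W hW =>
    ⟨hW.1.inter hoa', hW.2.1.of_isClosed_subset isClosed_closure (closure_mono inter_subset_left),
      fun x hx => ⟨hW.2.2 (closure_mono inter_subset_left hx),
        lt_of_lt_of_le hra' (hcla' (closure_mono inter_subset_right hx))⟩⟩
  -- `V` is enlarged so that `v₂` is close to `u` on the whole transition zone `E`, not only on `V`.
  have hV' : CompactlyInside (V ∪ {x | ρ x < b'}) U := by
    refine ⟨hV.1.union hob', ?_, ?_⟩ <;> rw [closure_union]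
    · exact hV.2.1.union hV₁.2.1
    · exact union_subset hV.2.2 (hV₁.2.2.trans hsU)
  set E : Set X := {x | ρ x < b'} ∩ {x | a' < ρ x} with hE
  have hEo : IsOpen E := hob'.inter hoa'
  -- Chosen so that the L¹ error `2δ` and the cutoff term `l * 2δ` add up to `ε`.
  set δ : ℝ≥0∞ := ε / (2 * (1 + l)) with hδ
  have hlt : (2 * (1 + l)) ≠ ∞ := by finiteness
  have hl0 : (2 * (1 + l)) ≠ 0 := by simp
  have hδ0 : δ ≠ 0 := (ENNReal.div_pos hε hlt).ne'
  have hδε : (1 + l) * (δ + δ) = ε := by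
    rw [← two_mul, ← mul_assoc, mul_comm (1 + l) 2, hδ, ENNReal.mul_div_cancel hl0 hlt]
  obtain ⟨v₁, g₁, hv₁, hg₁, hvu₁, hgM₁⟩ := exists_approx_of_variationOpen_lt h₁ hδ0 hV₁
  obtain ⟨v₂, g₂, hv₂, hg₂, hvu₂, hgM₂⟩ := exists_approx_of_variationOpen_lt h₂ hδ0 (hV₂ _ hV')
  have hE₁ : E ⊆ {x | ρ x < b'} := inter_subset_left
  have hE₂ : E ⊆ (V ∪ {x | ρ x < b'}) ∩ {x | a' < ρ x} :=
    fun x hx => ⟨Or.inr hx.1, hx.2⟩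
  have hm₁ : AEStronglyMeasurable v₁ (μ.restrict E) :=
    ((hv₁ _ hV₁).1.mono_set hE₁).aestronglyMeasurable
  have hm₂ : AEStronglyMeasurable v₂ (μ.restrict E) :=
    ((hv₂ _ (hV₂ _ hV')).1.mono_set hE₂).aestronglyMeasurable
  obtain ⟨h, hhm, hhge, hhint⟩ := exists_measurable_ge_setLIntegral_eq
    (f := fun x => l * ‖v₁ x - v₂ x‖ₑ) (μ := μ.restrict E) ((hm₁.sub hm₂).enorm.const_mul l)
  have hhle : ∫⁻ x in E, h x ∂μ ≤ l * (δ + δ) := by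
    rw [hhint, lintegral_const_mul' _ _ ENNReal.ofReal_ne_top]
    gcongr
    refine (setLIntegral_enorm_sub_le (v := u) (hm₁.sub hum.restrict)).trans ?_
    refine add_le_add ((lintegral_mono_set hE₁).trans hvu₁) ?_
    simp_rw [← enorm_neg (u _ - v₂ _), neg_sub]
    exact (lintegral_mono_set hE₂).trans hvu₂
  set φ := rampCutoff ρ a b with hφ
  set w : X → ℝ := fun x => φ x * v₁ x + (1 - φ x) * v₂ x with hw
  set G₁ := {x | ρ x < s}.indicator g₁ with hG₁
  set G₂ := (U ∩ {x | r < ρ x}).indicator g₂ with hG₂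
  set H := E.indicator h with hH
  have hS₁ : MeasurableSet {x | ρ x < s} := (isOpen_lt hρc continuous_const).measurableSet
  have hS₂ : MeasurableSet (U ∩ {x | r < ρ x}) :=
    (hU.inter (isOpen_lt continuous_const hρc)).measurableSet
  have hGm₁ : Measurable G₁ := hg₁.1.indicator hS₁
  have hGm₂ : Measurable G₂ := hg₂.1.indicator hS₂
  have hHm : Measurable H := hhm.indicator hEo.measurableSet
  have hGm : Measurable (G₁ + G₂ + H) := (hGm₁.add hGm₂).add hHm
  -- Locally `w` is `v₁` where `ρ < a`, `v₂` where `ρ > b`, and a convex combination on `E`, where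
  -- the Leibniz rule applies.
  have hug : IsUpperGradientOn w (G₁ + G₂ + H) U := by
    refine IsUpperGradientOn.of_local hGm fun x hx => ?_
    rcases lt_or_ge (ρ x) a with hxa | hxa
    · refine ⟨{y | ρ y < a}, isOpen_lt hρc continuous_const, hxa, ?_⟩
      have hsub : U ∩ {y | ρ y < a} ⊆ {y | ρ y < s} :=
        fun y hy => (show ρ y < a from hy.2).trans (hab'.trans hb's)
      refine ((hg₁.mono hsub).mono_gradient hGm fun y hy => ?_).congr fun y hy => ?_
      · simp only [Pi.add_apply]
        rw [hG₁, indicator_of_mem (hsub hy), add_assoc]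
        exact le_self_add
      · simp only [hw]
        rw [hφ, rampCutoff_eq_one hab (le_of_lt hy.2)]
        ring
    rcases lt_or_ge b (ρ x) with hxb | hxb
    · refine ⟨{y | b < ρ y}, isOpen_lt continuous_const hρc, hxb, ?_⟩
      have hsub : U ∩ {y | b < ρ y} ⊆ U ∩ {y | r < ρ y} :=
        fun y hy => ⟨hy.1, ((hra'.trans ha'a).trans hab).trans hy.2⟩
      refine ((hg₂.mono hsub).mono_gradient hGm fun y hy => ?_).congr fun y hy => ?_
      · simp only [Pi.add_apply]
        rw [hG₂, indicator_of_mem (hsub hy), add_comm (G₁ y), add_assoc]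
        exact le_self_add
      · simp only [hw]
        rw [hφ, rampCutoff_eq_zero hab (le_of_lt hy.2)]
        ring
    · refine ⟨E, hEo, ⟨hxb.trans_lt hbb', ha'a.trans_le hxa⟩, ?_⟩
      have hsub₁ : U ∩ E ⊆ {y | ρ y < s} :=
        fun y hy => (show ρ y < b' from hy.2.1).trans hb's
      have hsub₂ : U ∩ E ⊆ U ∩ {y | r < ρ y} := fun y hy => ⟨hy.1, hra'.trans hy.2.2⟩
      refine ((hg₁.mono hsub₁).convexComb (hg₂.mono hsub₂) (rampCutoff_nonneg ρ a b)
        (rampCutoff_le_one ρ a b) (inv_nonneg.2 (sub_nonneg.2 hab.le))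
        (abs_rampCutoff_sub_le hρ hab) hhm fun y _ => hhge y).mono_gradient hGm fun y hy => ?_
      simp only [Pi.add_apply]
      rw [hG₁, hG₂, hH, indicator_of_mem (hsub₁ hy), indicator_of_mem (hsub₂ hy),
        indicator_of_mem hy.2]
  have hGint : ∫⁻ x in U, (G₁ + G₂ + H) x ∂μ ≤ M₁ + M₂ + ε := by
    calc ∫⁻ x in U, (G₁ + G₂ + H) x ∂μ ≤ ∫⁻ x, (G₁ x + G₂ x + H x) ∂μ :=
          setLIntegral_le_lintegral _ _
      _ = (∫⁻ x, G₁ x ∂μ) + (∫⁻ x, G₂ x ∂μ) + ∫⁻ x, H x ∂μ := by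
          rw [lintegral_add_right _ hHm, lintegral_add_right _ hGm₂]
      _ ≤ M₁ + M₂ + l * (δ + δ) := by
          refine add_le_add (add_le_add ?_ ?_) ?_
          · exact (lintegral_indicator_le _ _).trans hgM₁.le
          · exact (lintegral_indicator_le _ _).trans hgM₂.le
          · exact (lintegral_indicator_le _ _).trans hhle
      _ ≤ M₁ + M₂ + ε := by
          gcongr
          rw [← hδε]
          gcongr
          exact le_add_self
  have hφm : AEStronglyMeasurable φ μ := by
    have : Continuous φ := by
      rw [hφ]
      unfold rampCutoff
      fun_prop
    exact this.aestronglyMeasurable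
  refine ⟨w, G₁ + G₂ + H, memNewtonianLoc_of_integrableOn (fun W hW => ?_) hug
    (hGint.trans_lt (by finiteness)), hug, ?_, hGint⟩
  · have hi₁ : Integrable ({x | ρ x < b'}.indicator v₁) (μ.restrict W) :=
      ((integrable_indicator_iff hob'.measurableSet).2 (hv₁ _ hV₁).1).restrict
    have hi₂ : Integrable ({x | a' < ρ x}.indicator v₂) (μ.restrict W) := by
      rw [integrable_indicator_iff hoa'.measurableSet, IntegrableOn,
        Measure.restrict_restrict hoa'.measurableSet, inter_comm]
      exact (hv₂ _ (hV₂ W hW)).1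
    have hb₁ : ∀ x, ‖φ x‖ ≤ 1 := fun x => by
      rw [Real.norm_of_nonneg (rampCutoff_nonneg ρ a b x)]; exact rampCutoff_le_one ρ a b x
    have hb₂ : ∀ x, ‖1 - φ x‖ ≤ 1 := fun x => by
      rw [Real.norm_of_nonneg (sub_nonneg.2 (rampCutoff_le_one ρ a b x))]
      linarith [rampCutoff_nonneg ρ a b x]
    have := (hi₁.bdd_mul hφm.restrict (Eventually.of_forall hb₁)).add
      (hi₂.bdd_mul (f := fun x => 1 - φ x) (aestronglyMeasurable_const.sub hφm.restrict) (Eventually.of_forall hb₂))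
    refine this.congr (Eventually.of_forall fun x => ?_)
    simp only [Pi.add_apply, hw]
    congr 1
    · by_cases hx : ρ x < b'
      · rw [indicator_of_mem (by exact hx)]
      · rw [hφ, rampCutoff_eq_zero hab (hbb'.le.trans (not_lt.1 hx))]
        simp
    · by_cases hx : a' < ρ x
      · rw [indicator_of_mem (by exact hx)]
      · rw [hφ, rampCutoff_eq_one hab ((not_lt.1 hx).trans ha'a.le)]
        simp
  · have hdm : AEMeasurable ({x | ρ x < b'}.indicator fun x => ‖v₁ x - u x‖ₑ) μ := by
      rw [aemeasurable_indicator_iff hob'.measurableSet]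
      exact ((hv₁ _ hV₁).1.aestronglyMeasurable.sub hum.restrict).enorm
    calc ∫⁻ x in V, ‖w x - u x‖ₑ ∂μ
        ≤ ∫⁻ x in V, ({x | ρ x < b'}.indicator (fun x => ‖v₁ x - u x‖ₑ) x
            + {x | a' < ρ x}.indicator (fun x => ‖v₂ x - u x‖ₑ) x) ∂μ := by
          refine lintegral_mono fun x => ?_
          refine le_trans (le_of_eq ?_)
            (enorm_ramp_comb_le (v := fun x => v₁ x - u x) (v' := fun x => v₂ x - u x)
              hab ha'a hbb' x)
          simp only [hw, hφ]
          congr 1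
          ring
      _ = (∫⁻ x in V, {x | ρ x < b'}.indicator (fun x => ‖v₁ x - u x‖ₑ) x ∂μ)
            + ∫⁻ x in V, {x | a' < ρ x}.indicator (fun x => ‖v₂ x - u x‖ₑ) x ∂μ :=
          lintegral_add_left' hdm.restrict _
      _ ≤ δ + δ := by
          refine add_le_add ?_ ?_
          · refine (setLIntegral_le_lintegral _ _).trans ?_
            exact (lintegral_indicator_le _ _).trans hvu₁
          · refine (lintegral_indicator_le _ _).trans ?_
            rw [Measure.restrict_restrict hoa'.measurableSet, inter_comm]
            exact (lintegral_mono_set (inter_subset_inter_left _ subset_union_left)).trans hvu₂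
      _ ≤ ε := by
          rw [← hδε]
          exact le_mul_of_one_le_left' le_self_add

/-- The total variation of a function vanishing off a compact set is concentrated there. -/
theorem variationOpen_univ_le_variation_of_ae_eq_zero [BorelSpace X] [ProperSpace X]
    {K : Set X} (hK : IsCompact K) {w : X → ℝ} (hwm : AEStronglyMeasurable w μ)
    (hw : ∀ᵐ x ∂μ, x ∉ K → w x = 0) :
    variationOpen μ w univ ≤ variation μ w K := by
  obtain ⟨ρ, hρ, hcomp, rfl⟩ := exists_lipschitz_gauge hK
  refine le_iInf fun U => le_iInf fun hU => le_iInf fun hKU => ?_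
  obtain ⟨s, hs, hsU⟩ := exists_sublevel_subset hρ.continuous hcomp hU hKU
  refine (variationOpen_le_add_of_collar isOpen_univ hρ (half_lt_self hs) hcomp
    (subset_univ _) hwm).trans ?_
  have hzero : variationOpen μ w (univ ∩ {x | s / 2 < ρ x}) = 0 := by
    refine le_antisymm ((variationOpen_congr_le (u' := 0) ?_).trans (variationOpen_zero _).le)
      zero_le
    have hm : MeasurableSet (univ ∩ {x | s / 2 < ρ x}) :=
      (isOpen_univ.inter (isOpen_lt continuous_const hρ.continuous)).measurableSet
    rw [ae_restrict_iff' hm]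
    filter_upwards [hw] with x hx hmem
    exact hx (not_le.2 ((half_pos hs).trans hmem.2))
  rw [hzero, add_zero]
  exact variationOpen_mono w hsU

/-- Otherwise rings of variation above `ε` could be split off successively toward `{ρ ≤ 0}`; being
disjoint, they would exceed the finite total. This replaces continuity of a measure along shrinking
sets. -/
theorem exists_variationOpen_slice_le [BorelSpace X] {ρ : X → ℝ} (hρc : Continuous ρ)
    {u : X → ℝ} (hu : variationOpen μ u univ ≠ ∞) {ε : ℝ≥0∞} (hε : ε ≠ 0) :
    ∃ R > 0, ∀ r, 0 < r → r < R → variationOpen μ u {x | r < ρ x ∧ ρ x < R} ≤ ε := by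
  by_contra! hcon
  have key : ∀ n : ℕ, ∃ R > 0, n * ε ≤ variationOpen μ u {x | R < ρ x} := by
    intro n
    induction n with
    | zero => exact ⟨1, one_pos, by simp⟩
    | succ n ih =>
      obtain ⟨R, hR, hn⟩ := ih
      obtain ⟨r, hr, hrR, hlt⟩ := hcon R hR
      refine ⟨r, hr, ?_⟩
      push_cast
      rw [add_mul, one_mul]
      refine (add_le_add hn hlt.le).trans (variationOpen_add_disjoint u ?_ ?_ ?_ ?_)
      · exact (isOpen_lt continuous_const hρc).inter (isOpen_lt hρc continuous_const)
      · exact disjoint_left.2 fun x hx hx' => lt_asymm hx hx'.2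
      · exact fun x hx => hrR.trans hx
      · exact fun x hx => hx.1
  obtain ⟨n, hn⟩ := ENNReal.exists_nat_mul_gt hε hu
  obtain ⟨R, _, hR⟩ := key n
  exact absurd (hR.trans (variationOpen_mono u (subset_univ _))) (not_le.2 hn)

/-- Lower semicontinuity of the total variation on a compact set, for functions with fixed values
off that set. -/
theorem variation_compact_le_of_tendsto [BorelSpace X] [ProperSpace X]
    {K : Set X} (hK : IsCompact K) {w : ℕ → X → ℝ} {u : X → ℝ}
    (hwm : ∀ k, AEStronglyMeasurable (w k) μ) (hwu : ∀ k, ∀ᵐ x ∂μ, x ∉ K → w k x = u x)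
    (hlim : TendstoL1Loc μ w u univ) (hu : variationOpen μ u univ ≠ ∞) {M : ℝ≥0∞}
    (hM : ∃ᶠ k in atTop, variation μ (w k) K ≤ M) : variation μ u K ≤ M := by
  obtain ⟨ρ, hρ, hcomp, rfl⟩ := exists_lipschitz_gauge hK
  have hρc := hρ.continuous
  by_cases hMt : M = ∞
  · simp [hMt]
  refine ENNReal.le_of_forall_pos_le_add fun ε hε _ => ?_
  have hε2 : ((ε / 2 : ℝ≥0) : ℝ≥0∞) ≠ 0 := by simpa using (half_pos hε).ne'
  obtain ⟨R, hR, hslice⟩ := exists_variationOpen_slice_le hρc hu hε2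
  have hUo : IsOpen {x | ρ x < R} := isOpen_lt hρc continuous_const
  refine (variation_le_variationOpen u hUo (fun x hx => lt_of_le_of_lt hx hR)).trans ?_
  refine variationOpen_le_of_tendsto hUo hwm (hlim.mono (subset_univ _)) (hM.mono fun k hk => ?_)
  obtain ⟨O, hO, hKO, hlt⟩ := exists_isOpen_variationOpen_lt
    (hk.trans_lt (ENNReal.lt_add_right hMt hε2))
  obtain ⟨s₀, hs₀, hs₀O⟩ := exists_sublevel_subset hρc hcomp hO hKO
  set s := min s₀ (R / 2) with hs
  have hspos : 0 < s := lt_min hs₀ (half_pos hR)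
  have hsR : s < R := (min_le_right _ _).trans_lt (half_lt_self hR)
  have hset : {x | ρ x < R} ∩ {x | s / 2 < ρ x} = {x | s / 2 < ρ x ∧ ρ x < R} := by
    ext x; exact and_comm
  -- Off `K` the functions `w k` and `u` agree, so one choice of `R` works for every `k`.
  have houter : variationOpen μ (w k) ({x | ρ x < R} ∩ {x | s / 2 < ρ x}) ≤ (ε / 2 : ℝ≥0) := by
    refine le_trans (variationOpen_congr_le (u' := u) ?_)
      (hset ▸ hslice (s / 2) (half_pos hspos) ((half_lt_self hspos).trans hsR))
    rw [ae_restrict_iff' (hUo.inter (isOpen_lt continuous_const hρc)).measurableSet]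
    filter_upwards [hwu k] with x hx hmem
    exact hx (not_le.2 ((half_pos hspos).trans hmem.2))
  calc variationOpen μ (w k) {x | ρ x < R}
      ≤ variationOpen μ (w k) {x | ρ x < s}
        + variationOpen μ (w k) ({x | ρ x < R} ∩ {x | s / 2 < ρ x}) :=
        variationOpen_le_add_of_collar hUo hρ (half_lt_self hspos) hcomp
          (fun x hx => lt_trans hx hsR) (hwm k)
    _ ≤ (M + (ε / 2 : ℝ≥0)) + (ε / 2 : ℝ≥0) := by
        refine add_le_add (le_trans (variationOpen_mono _ ?_) hlt.le) houter
        exact fun x hx => hs₀O (lt_of_lt_of_le hx (min_le_left _ _) : ρ x < s₀)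
    _ = M + ε := by rw [add_assoc, ← ENNReal.coe_add, add_halves]

end Gluing

/-! ### Doubling measures: separated sets, properness, bounded overlap -/

section Doubling

variable {X : Type*} [MetricSpace X] [MeasurableSpace X] {μ : Measure X} {cd : ℝ≥0}

/-- The doubling condition with a given constant. -/
def DoublingWith (μ : Measure X) (cd : ℝ≥0) : Prop :=
  ∀ (x : X) (r : ℝ), 0 < r →
    0 < μ (Metric.ball x (2 * r)) ∧
    μ (Metric.ball x (2 * r)) ≤ cd * μ (Metric.ball x r) ∧
    μ (Metric.ball x r) < ∞

theorem DoublingWith.measure_ball_ne_zero (h : DoublingWith μ cd) (x : X) {r : ℝ} (hr : 0 < r) :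
    μ (Metric.ball x r) ≠ 0 := by
  have := (h x (r / 2) (half_pos hr)).1.ne'
  rwa [mul_div_cancel₀ r two_ne_zero] at this

theorem DoublingWith.measure_ball_ne_top (h : DoublingWith μ cd) (x : X) (r : ℝ) :
    μ (Metric.ball x r) ≠ ∞ := by
  rcases le_or_gt r 0 with hr | hr
  · simp [Metric.ball_eq_empty.2 hr]
  · exact (h x r hr).2.2.ne

theorem DoublingWith.measure_ball_two_pow_le (h : DoublingWith μ cd) (x : X) {r : ℝ} (hr : 0 < r)
    (m : ℕ) : μ (Metric.ball x (2 ^ m * r)) ≤ (cd : ℝ≥0∞) ^ m * μ (Metric.ball x r) := by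
  induction m with
  | zero => simp
  | succ m ih =>
    calc μ (Metric.ball x (2 ^ (m + 1) * r)) = μ (Metric.ball x (2 * (2 ^ m * r))) := by
          congr 2; ring
      _ ≤ cd * μ (Metric.ball x (2 ^ m * r)) := (h x _ (by positivity)).2.1
      _ ≤ cd * ((cd : ℝ≥0∞) ^ m * μ (Metric.ball x r)) := by gcongr
      _ = _ := by ring

variable [OpensMeasurableSpace X]

/-- Bounded sets contain boundedly many separated points. -/
theorem DoublingWith.card_le (h : DoublingWith μ cd) {T : Finset X} {p : X} {r R : ℝ} (hr : 0 < r)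
    (hR : 0 ≤ R) (hsep : ∀ x ∈ T, ∀ y ∈ T, x ≠ y → r ≤ dist x y) (hT : ∀ x ∈ T, dist x p < R)
    {m : ℕ} (hm : 2 * R + r ≤ 2 ^ m * (r / 2)) : (T.card : ℝ≥0∞) ≤ (cd : ℝ≥0∞) ^ m := by
  have hB0 := h.measure_ball_ne_zero p (add_pos_of_nonneg_of_pos hR hr)
  have hBt := h.measure_ball_ne_top p (R + r)
  rw [← ENNReal.mul_le_mul_iff_left hB0 hBt]
  -- The half-radius balls are disjoint inside `ball p (R + r)`, yet each has at least the fraction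
  -- `cd ^ (-m)` of its measure.
  have hdisj : (T : Set X).PairwiseDisjoint fun x => Metric.ball x (r / 2) := by
    intro x hx y hy hxy
    exact Metric.ball_disjoint_ball (by simpa using hsep x hx y hy hxy)
  calc (T.card : ℝ≥0∞) * μ (Metric.ball p (R + r))
      = ∑ _x ∈ T, μ (Metric.ball p (R + r)) := by simp
    _ ≤ ∑ x ∈ T, (cd : ℝ≥0∞) ^ m * μ (Metric.ball x (r / 2)) := by
        refine Finset.sum_le_sum fun x hx => le_trans (measure_mono ?_)
          (h.measure_ball_two_pow_le x (half_pos hr) m)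
        refine Metric.ball_subset_ball' ?_
        have := hT x hx
        rw [dist_comm] at this
        linarith
    _ = (cd : ℝ≥0∞) ^ m * μ (⋃ x ∈ T, Metric.ball x (r / 2)) := by
        rw [measure_biUnion_finset hdisj fun _ _ => Metric.isOpen_ball.measurableSet,
          Finset.mul_sum]
    _ ≤ (cd : ℝ≥0∞) ^ m * μ (Metric.ball p (R + r)) := by
        gcongr
        refine iUnion₂_subset fun x hx => Metric.ball_subset_ball' ?_
        linarith [hT x hx]

/-- If no finite separated set were a net, each could be enlarged by a point, against the
cardinality bound. -/
theorem DoublingWith.exists_net (h : DoublingWith μ cd) {S : Set X} {p : X} {R r : ℝ}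
    (hr : 0 < r) (hS : S ⊆ Metric.ball p R) :
    ∃ T : Finset X, (T : Set X) ⊆ S ∧ (∀ x ∈ T, ∀ y ∈ T, x ≠ y → r ≤ dist x y) ∧
      ∀ y ∈ S, ∃ x ∈ T, dist y x < r := by
  classical
  by_contra! hcon
  have key : ∀ n : ℕ, ∃ T : Finset X, (T : Set X) ⊆ S ∧
      (∀ x ∈ T, ∀ y ∈ T, x ≠ y → r ≤ dist x y) ∧ T.card = n := by
    intro n
    induction n with
    | zero => exact ⟨∅, by simp, by simp, rfl⟩
    | succ n ih =>
      obtain ⟨T, hTS, hsep, hcard⟩ := ih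
      obtain ⟨y, hyS, hy⟩ := hcon T hTS hsep
      have hyT : y ∉ T := fun hyT => absurd (hy y hyT) (by simp [hr])
      refine ⟨insert y T, ?_, ?_, by rw [Finset.card_insert_of_notMem hyT, hcard]⟩
      · rw [Finset.coe_insert]
        exact insert_subset hyS hTS
      · intro a ha b hb hab
        rcases Finset.mem_insert.1 ha with rfl | haT <;> rcases Finset.mem_insert.1 hb with rfl | hbT
        · exact absurd rfl hab
        · exact hy b hbT
        · rw [dist_comm]; exact hy a haT
        · exact hsep a haT b hbT hab
  have hR : 0 ≤ max R 0 := le_max_right _ _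
  obtain ⟨m, hm⟩ := pow_unbounded_of_one_lt ((2 * max R 0 + r) / (r / 2)) one_lt_two
  rw [div_lt_iff₀ (half_pos hr)] at hm
  obtain ⟨N, hN⟩ := ENNReal.exists_nat_gt (r := (cd : ℝ≥0∞) ^ m) (by finiteness)
  obtain ⟨T, hTS, hsep, hcard⟩ := key N
  have := h.card_le hr hR hsep
    (fun x hx => (Metric.mem_ball.1 (hS (hTS hx))).trans_le (le_max_left _ _)) hm.le
  rw [hcard] at this
  exact absurd hN (not_lt.2 this)

theorem DoublingWith.properSpace [CompleteSpace X] (h : DoublingWith μ cd) : ProperSpace X := by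
  refine ⟨fun x r => TotallyBounded.isCompact_of_isClosed ?_ Metric.isClosed_closedBall⟩
  rw [Metric.totallyBounded_iff]
  intro ε hε
  obtain ⟨T, _, _, hT⟩ := h.exists_net hε (Metric.closedBall_subset_ball (lt_add_one r) (x := x))
  refine ⟨T, T.finite_toSet, fun y hy => ?_⟩
  obtain ⟨z, hz, hyz⟩ := hT y hy
  exact mem_iUnion₂.2 ⟨z, hz, hyz⟩

/-- The dilations of balls with separated centers have bounded overlap. -/
theorem DoublingWith.sum_setLIntegral_le (h : DoublingWith μ cd) {T : Finset X} {r lam : ℝ}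
    (hr : 0 < r) (hlam : 0 ≤ lam) (hsep : ∀ x ∈ T, ∀ y ∈ T, x ≠ y → r ≤ dist x y) {m : ℕ}
    (hm : 4 * lam + 2 ≤ 2 ^ m) {g : X → ℝ≥0∞} (hg : Measurable g) :
    ∑ x ∈ T, ∫⁻ y in Metric.ball x (lam * r), g y ∂μ ≤ (cd : ℝ≥0∞) ^ m * ∫⁻ y, g y ∂μ := by
  classical
  have hind : ∀ x : X, Measurable ((Metric.ball x (lam * r)).indicator g) :=
    fun x => hg.indicator Metric.isOpen_ball.measurableSet
  simp_rw [← lintegral_indicator Metric.isOpen_ball.measurableSet]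
  rw [← lintegral_finsetSum _ fun x _ => hind x, ← lintegral_const_mul _ hg]
  refine lintegral_mono fun y => ?_
  have hsum : ∑ x ∈ T, (Metric.ball x (lam * r)).indicator g y =
      ((T.filter fun x => dist x y < lam * r).card : ℝ≥0∞) * g y := by
    rw [← nsmul_eq_mul, ← Finset.sum_const, Finset.sum_filter]
    refine Finset.sum_congr rfl fun x _ => ?_
    simp only [indicator_apply, Metric.mem_ball, dist_comm y x]
  simp only
  rw [hsum]
  gcongr
  refine h.card_le hr (mul_nonneg hlam hr.le)
    (fun a ha b hb => hsep a (Finset.mem_filter.1 ha).1 b (Finset.mem_filter.1 hb).1)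
    (fun x hx => (Finset.mem_filter.1 hx).2) ?_
  nlinarith [mul_le_mul_of_nonneg_right hm (half_pos hr).le]

end Doubling

/-! ### Consequences of the Poincaré inequality: norm bounds and compactness -/

section Poincare

theorem compactlyInside_ball_univ {X : Type*} [MetricSpace X] [ProperSpace X] (p : X) (r : ℝ) : CompactlyInside (Metric.ball p r) univ :=
  ⟨Metric.isOpen_ball, (isCompact_closedBall p r).of_isClosed_subset isClosed_closure
    Metric.closure_ball_subset_closedBall, subset_univ _⟩

theorem MemNewtonianLoc.locallyIntegrable {X : Type*} [MetricSpace X] [MeasurableSpace X]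
    [ProperSpace X] {μ : Measure X} {v : X → ℝ} (hv : MemNewtonianLoc μ v univ) :
    LocallyIntegrable v μ := fun x =>
  ⟨Metric.ball x 1, Metric.ball_mem_nhds x one_pos, (hv _ (compactlyInside_ball_univ x 1)).1⟩

/-- The Poincaré inequality with given constants, in integrated form. -/
def PoincareWith {X : Type*} [MetricSpace X] [MeasurableSpace X] (μ : Measure X) (cP lam : ℝ) : Prop :=
  ∀ (x : X) (r : ℝ), 0 < r → ∀ (v : X → ℝ) (g : X → ℝ≥0∞), MemNewtonianLoc μ v univ →
    IsUpperGradientOn v g univ →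
      ∫⁻ y in Metric.ball x r, ‖v y - ⨍ z in Metric.ball x r, v z ∂μ‖ₑ ∂μ ≤
        ENNReal.ofReal (cP * r) * ∫⁻ y in Metric.ball x (lam * r), g y ∂μ

/-- Clearing the averages costs no constant, because the dilated ball has the larger measure. -/
theorem SupportsPoincare.exists_poincareWith {X : Type*} [MetricSpace X] [MeasurableSpace X]
    [ProperSpace X] {μ : Measure X} {cd : ℝ≥0} (hd : DoublingWith μ cd)
    (h : SupportsPoincare μ) :
    ∃ cP lam : ℝ, 0 < cP ∧ 1 ≤ lam ∧ PoincareWith μ cP lam := by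
  obtain ⟨cP, lam, hcP, hlam, hP⟩ := h
  refine ⟨cP, lam, hcP, hlam, fun x r hr v g hv hg => ?_⟩
  have key := hP x r hr v g hv.locallyIntegrable hg
  have h0 := hd.measure_ball_ne_zero x hr
  have ht := hd.measure_ball_ne_top x r
  rw [setLAverage_eq, setLAverage_eq, ENNReal.div_le_iff h0 ht] at key
  refine key.trans ?_
  rw [mul_assoc]
  gcongr
  calc (∫⁻ y in Metric.ball x (lam * r), g y ∂μ) / μ (Metric.ball x (lam * r)) * μ (Metric.ball x r)
      ≤ (∫⁻ y in Metric.ball x (lam * r), g y ∂μ) / μ (Metric.ball x (lam * r))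
          * μ (Metric.ball x (lam * r)) := by
        gcongr
        exact le_mul_of_one_le_left hr.le hlam
    _ ≤ _ := by
        rw [mul_comm]
        exact ENNReal.mul_div_le

variable {X : Type*} [MetricSpace X] [MeasurableSpace X] [BorelSpace X] [ProperSpace X]
  {μ : Measure X} {cd : ℝ≥0}

/-- A Maz'ya type inequality for functions vanishing off a bounded set. -/
theorem exists_lintegral_le_mul_variationOpen (hd : DoublingWith μ cd) (h : SupportsPoincare μ)
    {Ω : Set X} (hΩ : IsOpen Ω) (hΩb : Bornology.IsBounded Ω) (hΩc : 0 < μ Ωᶜ) :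
    ∃ C : ℝ≥0∞, C ≠ ∞ ∧ ∀ (w : X → ℝ) (M : ℝ≥0∞), Integrable w μ →
      (∀ᵐ x ∂μ, x ∉ Ω → w x = 0) → variationOpen μ w univ < M →
        ∫⁻ x, ‖w x‖ₑ ∂μ ≤ C * M := by
  obtain ⟨cP, lam, hcP, hlam, hP⟩ := h.exists_poincareWith hd
  obtain ⟨p, -⟩ : (Ωᶜ).Nonempty := nonempty_of_measure_ne_zero hΩc.ne'
  obtain ⟨n, hn⟩ : ∃ n : ℕ, μ (Metric.ball p n ∩ Ωᶜ) ≠ 0 := by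
    by_contra! hcon
    refine hΩc.ne' ?_
    rw [← univ_inter Ωᶜ, ← Metric.iUnion_ball_nat p, iUnion_inter]
    exact measure_iUnion_null hcon
  obtain ⟨R, hnR, hR⟩ := hΩb.subset_ball_lt n p
  have hRpos : 0 < R := lt_of_le_of_lt (Nat.cast_nonneg n) hnR
  set B := Metric.ball p R with hB
  set S := B ∩ Ωᶜ with hS
  have hSB : S ⊆ B := inter_subset_left
  have hS0 : μ S ≠ 0 := fun h0 => hn (measure_mono_null
    (inter_subset_inter_left _ (Metric.ball_subset_ball hnR.le)) h0)
  have hBt : μ B ≠ ∞ := hd.measure_ball_ne_top p R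
  have hSt : μ S ≠ ∞ := measure_ne_top_of_subset hSB hBt
  have hSm : MeasurableSet S := Metric.isOpen_ball.measurableSet.inter hΩ.measurableSet.compl
  set c := ENNReal.ofReal (cP * R) with hc
  refine ⟨(1 + c) * (1 + μ B / μ S), ?_, fun w M hwi hw0 hM => ?_⟩
  · exact ENNReal.mul_ne_top (by finiteness) (ENNReal.add_ne_top.2 ⟨by simp,
      ENNReal.div_ne_top hBt hS0⟩)
  have hM0 : M ≠ 0 := (pos_of_gt hM).ne'
  obtain ⟨v, g, hv, hg, hvw, hgM⟩ := exists_approx_of_variationOpen_lt hM hM0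
    (compactlyInside_ball_univ p R)
  have hvB : IntegrableOn v B μ := (hv _ (compactlyInside_ball_univ p R)).1
  set a : ℝ := ⨍ z in B, v z ∂μ with ha
  have hpoin : ∫⁻ y in B, ‖v y - a‖ₑ ∂μ ≤ c * M := by
    refine (hP p R hRpos v g hv hg).trans ?_
    gcongr
    exact (lintegral_mono_set (subset_univ _)).trans hgM.le
  have hwa : ∫⁻ y in B, ‖w y - a‖ₑ ∂μ ≤ (1 + c) * M := by
    refine (setLIntegral_enorm_sub_le (v := v)
      (hwi.aestronglyMeasurable.restrict.sub hvB.aestronglyMeasurable)).trans ?_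
    rw [add_mul, one_mul]
    refine add_le_add ?_ hpoin
    simp_rw [← enorm_neg (w _ - v _), neg_sub]
    exact hvw
  -- On `S` the function `w` vanishes, so `‖w - a‖ₑ` is the constant `‖a‖ₑ`; this controls the mean
  -- `a`.
  have hae : ‖a‖ₑ * μ S ≤ (1 + c) * M := by
    refine le_trans (le_of_eq ?_) ((lintegral_mono_set hSB).trans hwa)
    rw [← setLIntegral_const]
    refine lintegral_congr_ae ?_
    rw [EventuallyEq, ae_restrict_iff' hSm]
    filter_upwards [hw0] with x hx hxS
    rw [hx hxS.2, zero_sub, enorm_neg]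
  have hae' : ‖a‖ₑ ≤ (1 + c) * M / μ S := by
    rwa [ENNReal.le_div_iff_mul_le (Or.inl hS0) (Or.inl hSt)]
  calc ∫⁻ x, ‖w x‖ₑ ∂μ = ∫⁻ x in B, ‖w x‖ₑ ∂μ := by
        symm
        rw [← lintegral_indicator Metric.isOpen_ball.measurableSet]
        refine lintegral_congr_ae ?_
        filter_upwards [hw0] with x hx
        by_cases hxB : x ∈ B
        · rw [indicator_of_mem hxB]
        · rw [indicator_of_notMem hxB, hx fun hxΩ => hxB (hR hxΩ), enorm_zero]
    _ ≤ ∫⁻ x in B, (‖w x - a‖ₑ + ‖a‖ₑ) ∂μ := by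
        refine lintegral_mono fun x => ?_
        calc ‖w x‖ₑ = ‖(w x - a) + a‖ₑ := by ring_nf
          _ ≤ _ := enorm_add_le _ _
    _ = (∫⁻ x in B, ‖w x - a‖ₑ ∂μ) + ‖a‖ₑ * μ B := by
        rw [lintegral_add_right _ measurable_const, setLIntegral_const]
    _ ≤ (1 + c) * M + (1 + c) * M / μ S * μ B := by gcongr
    _ = (1 + c) * (1 + μ B / μ S) * M := by
        rw [ENNReal.div_eq_inv_mul, ENNReal.div_eq_inv_mul]
        ring

/-- Functions of bounded variation are uniformly approximated by functions that are constant on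
the pieces of a finite partition. -/
theorem exists_piecewise_approx (hd : DoublingWith μ cd) (h : SupportsPoincare μ)
    {Ω : Set X} (hΩb : Bornology.IsBounded Ω) {A M ε : ℝ≥0∞} (hA : A ≠ ∞) (hM : M ≠ ∞)
    (hε : ε ≠ 0) (hεt : ε ≠ ∞) :
    ∃ (n : ℕ) (E : Fin n → Set X) (D : Fin n → ℝ), (∀ i, MeasurableSet (E i)) ∧
      (∀ i, μ (E i) ≠ ∞) ∧ ∀ w : X → ℝ, Integrable w μ → ∫⁻ x, ‖w x‖ₑ ∂μ ≤ A →
        variationOpen μ w univ < M → ∃ c : Fin n → ℝ, (∀ i, c i ∈ Icc (-D i) (D i)) ∧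
          ∫⁻ x in Ω, ‖w x - ∑ i, (E i).indicator (fun _ => c i) x‖ₑ ∂μ ≤ ε := by
  obtain ⟨cP, lam, hcP, hlam, hP⟩ := h.exists_poincareWith hd
  rcases isEmpty_or_nonempty X with hX | ⟨⟨p⟩⟩
  · refine ⟨0, fun _ => ∅, fun _ => 0, fun i => i.elim0, fun i => i.elim0, fun w _ _ _ =>
      ⟨fun _ => 0, fun i => i.elim0, ?_⟩⟩
    simp [eq_empty_of_isEmpty Ω]
  obtain ⟨R, hR0, hR⟩ := hΩb.subset_ball_lt 0 p
  obtain ⟨m, hm⟩ := pow_unbounded_of_one_lt (4 * lam + 2) (one_lt_two (α := ℝ))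
  set N : ℝ≥0∞ := (cd : ℝ≥0∞) ^ m with hN
  have hNt : N ≠ ∞ := by finiteness
  have hε2 : ε / 2 ≠ 0 := (ENNReal.half_pos hε).ne'
  -- The overlap constant `N` does not depend on the radius, so the Poincaré error is made small by
  -- shrinking `r`.
  obtain ⟨r, hr, hrε⟩ : ∃ r : ℝ, 0 < r ∧ ENNReal.ofReal (cP * r) * (N * M) ≤ ε / 2 := by
    have hlim : Tendsto (fun r : ℝ => ENNReal.ofReal (cP * r) * (N * M)) (𝓝[>] 0)
        (𝓝 (ENNReal.ofReal (cP * 0) * (N * M))) := by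
      refine Tendsto.mono_left ?_ nhdsWithin_le_nhds
      refine ENNReal.Tendsto.mul_const ?_ (Or.inr (ENNReal.mul_ne_top hNt hM))
      exact (ENNReal.continuous_ofReal.comp (continuous_const_mul cP)).tendsto 0
    rw [mul_zero, ENNReal.ofReal_zero, zero_mul] at hlim
    obtain ⟨r, hr1, hr2⟩ := ((hlim.eventually (Iic_mem_nhds (pos_iff_ne_zero.2 hε2))).and
      self_mem_nhdsWithin).exists
    exact ⟨r, hr2, hr1⟩
  obtain ⟨T, hTΩ, hsep, hcov⟩ := hd.exists_net hr hR
  set e := T.equivFin.symm with he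
  set B : Fin T.card → Set X := fun i => Metric.ball (e i : X) r with hBdef
  have hBm : ∀ i, MeasurableSet (B i) := fun i => Metric.isOpen_ball.measurableSet
  have hEB : ∀ i, disjointed B i ⊆ B i := fun i => disjointed_le B i
  have hEm : ∀ i, MeasurableSet (disjointed B i) := fun i => by
    rw [disjointed_apply]
    refine (hBm i).diff ?_
    rw [Finset.sup_set_eq_biUnion]
    exact Finset.measurableSet_biUnion _ fun j _ => hBm j
  have hBt : ∀ i, μ (B i) ≠ ∞ := fun i => hd.measure_ball_ne_top _ r
  have hB0 : ∀ i, μ (B i) ≠ 0 := fun i => hd.measure_ball_ne_zero _ hr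
  have hΩE : Ω ⊆ ⋃ i, disjointed B i := by
    rw [iUnion_disjointed]
    intro y hy
    obtain ⟨x, hx, hyx⟩ := hcov y hy
    refine mem_iUnion.2 ⟨T.equivFin ⟨x, hx⟩, ?_⟩
    simpa [hBdef, he] using hyx
  -- The bound on the coefficients comes from averaging `v` over a ball, where its L¹ norm is at
  -- most `ε / 2 + A`; it is independent of `w`.
  refine ⟨T.card, disjointed B, fun i => ((ε / 2 + A) / μ (B i)).toReal, hEm,
    fun i => measure_ne_top_of_subset (hEB i) (hBt i), fun w hwi hwA hwM => ?_⟩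
  obtain ⟨v, g, hv, hg, hvw, hgM⟩ := exists_approx_of_variationOpen_lt hwM hε2
    (compactlyInside_ball_univ p (R + r))
  have hBR : ∀ i, B i ⊆ Metric.ball p (R + r) := fun i => by
    refine Metric.ball_subset_ball' ?_
    have : dist (e i : X) p < R := hR (hTΩ (e i).2)
    linarith
  have hvi : IntegrableOn v (Metric.ball p (R + r)) μ := (hv _ (compactlyInside_ball_univ p _)).1
  set c : Fin T.card → ℝ := fun i => ⨍ z in B i, v z ∂μ with hcdef
  refine ⟨c, fun i => ?_, ?_⟩
  · rw [mem_Icc, ← abs_le]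
    have hvint : ∫⁻ y in B i, ‖v y‖ₑ ∂μ ≤ ε / 2 + A := by
      have := setLIntegral_enorm_sub_le (μ := μ) (S := B i) (u := v) (v := w) (w := fun _ => 0)
        ((hvi.mono_set (hBR i)).aestronglyMeasurable.sub hwi.aestronglyMeasurable.restrict)
      simp only [sub_zero] at this
      exact this.trans (add_le_add ((lintegral_mono_set (hBR i)).trans hvw)
        ((setLIntegral_le_lintegral _ _).trans hwA))
    have hne : (ε / 2 + A) / μ (B i) ≠ ∞ :=
      ENNReal.div_ne_top (ENNReal.add_ne_top.2 ⟨(ENNReal.half_lt_self hε hεt).ne_top, hA⟩) (hB0 i)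
    have hce : ‖c i‖ₑ ≤ (ε / 2 + A) / μ (B i) := by
      rw [ENNReal.le_div_iff_mul_le (Or.inl (hB0 i)) (Or.inl (hBt i))]
      refine le_trans ?_ hvint
      rw [hcdef]
      simp only
      rw [setAverage_eq, enorm_smul, mul_right_comm]
      have h1 : ‖(μ.real (B i))⁻¹‖ₑ * μ (B i) = 1 := by
        rw [← ofReal_norm, norm_inv, Real.norm_of_nonneg measureReal_nonneg, Measure.real,
          ENNReal.ofReal_inv_of_pos (ENNReal.toReal_pos (hB0 i) (hBt i)),
          ENNReal.ofReal_toReal (hBt i), ENNReal.inv_mul_cancel (hB0 i) (hBt i)]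
      rw [h1, one_mul]
      exact enorm_integral_le_lintegral_enorm _
    rw [← Real.norm_eq_abs, ← toReal_enorm]
    exact ENNReal.toReal_mono hne hce
  · set P : X → ℝ := fun x => ∑ i, (disjointed B i).indicator (fun _ => c i) x with hP'
    have hPE : ∀ i, ∀ x ∈ disjointed B i, P x = c i := by
      intro i x hx
      simp only [hP']
      rw [Finset.sum_eq_single i, indicator_of_mem hx]
      · intro j _ hji
        refine indicator_of_notMem (fun hxj => ?_) _
        exact disjoint_left.1 (disjoint_disjointed B hji) hxj hx
      · simp
    have hΩR : Ω ⊆ Metric.ball p (R + r) := hR.trans (Metric.ball_subset_ball (by linarith))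
    have hvP : ∫⁻ x in Ω, ‖v x - P x‖ₑ ∂μ ≤ ε / 2 := by
      calc ∫⁻ x in Ω, ‖v x - P x‖ₑ ∂μ
          ≤ ∫⁻ x in ⋃ i, disjointed B i, ‖v x - P x‖ₑ ∂μ := lintegral_mono_set hΩE
        _ ≤ ∑ i, ∫⁻ x in disjointed B i, ‖v x - P x‖ₑ ∂μ := 
            (lintegral_iUnion_le _ _).trans_eq (tsum_fintype _)
        _ ≤ ∑ i, ENNReal.ofReal (cP * r) * ∫⁻ y in Metric.ball (e i : X) (lam * r), g y ∂μ := by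
            refine Finset.sum_le_sum fun i _ => ?_
            rw [setLIntegral_congr_fun (g := fun x => ‖v x - c i‖ₑ) (hEm i)
              fun x hx => by simp only [hPE i x hx]]
            exact (lintegral_mono_set (hEB i)).trans (hP _ r hr v g hv hg)
        _ = ENNReal.ofReal (cP * r) * ∑ x ∈ T, ∫⁻ y in Metric.ball x (lam * r), g y ∂μ := by
            rw [← Finset.mul_sum, ← Finset.sum_coe_sort T]
            congr 1
            exact Equiv.sum_comp e fun x : T => ∫⁻ y in Metric.ball (x : X) (lam * r), g y ∂μ
        _ ≤ ENNReal.ofReal (cP * r) * (N * ∫⁻ y, g y ∂μ) := by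
            gcongr
            exact hd.sum_setLIntegral_le hr (zero_le_one.trans hlam) hsep hm.le hg.1
        _ ≤ ENNReal.ofReal (cP * r) * (N * M) := by
            gcongr
            simpa using hgM.le
        _ ≤ ε / 2 := hrε
    refine (setLIntegral_enorm_sub_le (v := v) (hwi.aestronglyMeasurable.restrict.sub
      (hvi.mono_set hΩR).aestronglyMeasurable)).trans ?_
    rw [← ENNReal.add_halves ε]
    refine add_le_add ?_ hvP
    simp_rw [← enorm_neg (w _ - v _), neg_sub]
    exact (lintegral_mono_set hΩR).trans hvw

/-- Compactness of bounded subsets of `BV` in `L¹` of a bounded set. -/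
theorem exists_subseq_tendstoL1 (hd : DoublingWith μ cd) (h : SupportsPoincare μ)
    {Ω : Set X} (hΩb : Bornology.IsBounded Ω) {A M : ℝ≥0∞} (hA : A ≠ ∞) (hM : M ≠ ∞)
    {w : ℕ → X → ℝ} (hwi : ∀ k, Integrable (w k) μ) (hwA : ∀ k, ∫⁻ x, ‖w k x‖ₑ ∂μ ≤ A)
    (hwM : ∀ k, variationOpen μ (w k) univ < M) :
    ∃ (v : X → ℝ) (φ : ℕ → ℕ), StrictMono φ ∧ IntegrableOn v Ω μ ∧
      TendstoL1 μ (fun k => w (φ k)) v Ω := by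
  set ν := μ.restrict Ω with hν
  have hwν : ∀ k, Integrable (w k) ν := fun k => (hwi k).restrict
  set F : ℕ → (X →₁[ν] ℝ) := fun k => (hwν k).toL1 (w k) with hF
  have htb : TotallyBounded (range F) := by
    rw [EMetric.totallyBounded_iff]
    intro ε hε
    obtain ⟨ε', hε'0, hε'⟩ : ∃ ε' : ℝ≥0∞, ε' ≠ 0 ∧ ε' ≠ ∞ ∧ ε' + ε' < ε := by
      obtain ⟨δ, hδ0, hδ⟩ := ENNReal.lt_iff_exists_nnreal_btwn.1 hε
      have hδ' : (δ : ℝ≥0∞) ≠ 0 := hδ0.ne'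
      exact ⟨δ / 2, (ENNReal.half_pos hδ').ne', (ENNReal.half_lt_self hδ' (by simp)).ne_top,
        by rwa [ENNReal.add_halves]⟩
    obtain ⟨n, E, D, hEm, hEt, happ⟩ := exists_piecewise_approx hd h hΩb hA hM hε'0 hε'.1
    have hint : ∀ c : Fin n → ℝ,
        Integrable (fun x => ∑ i, (E i).indicator (fun _ => c i) x) ν := fun c =>
      integrable_finsetSum _ fun i _ => (IntegrableOn.integrable_indicator
        (integrableOn_const (hEt i)) (hEm i)).restrict
    set Φ : (Fin n → ℝ) → (X →₁[ν] ℝ) := fun c => (hint c).toL1 _ with hΦ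
    have hΦlip : LipschitzWith (∑ i, μ (E i)).toNNReal Φ := by
      intro c c'
      rw [ENNReal.coe_toNNReal (ENNReal.sum_ne_top.2 fun i _ => hEt i), hΦ]
      simp only
      rw [Integrable.edist_toL1_toL1]
      calc ∫⁻ x, edist (∑ i, (E i).indicator (fun _ => c i) x)
            (∑ i, (E i).indicator (fun _ => c' i) x) ∂ν
          ≤ ∫⁻ x, edist (∑ i, (E i).indicator (fun _ => c i) x)
            (∑ i, (E i).indicator (fun _ => c' i) x) ∂μ := setLIntegral_le_lintegral _ _
        _ ≤ ∫⁻ x, ∑ i, (E i).indicator (fun _ => edist c c') x ∂μ := by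
            refine lintegral_mono fun x => ?_
            rw [edist_eq_enorm_sub, ← Finset.sum_sub_distrib]
            refine (enorm_sum_le _ _).trans (Finset.sum_le_sum fun i _ => ?_)
            by_cases hx : x ∈ E i
            · simp only [indicator_of_mem hx]
              rw [← edist_eq_enorm_sub]
              exact edist_le_pi_edist c c' i
            · simp [indicator_of_notMem hx]
        _ = (∑ i, μ (E i)) * edist c c' := by
            rw [lintegral_finsetSum _ fun i _ => measurable_const.indicator (hEm i), Finset.sum_mul]
            refine Finset.sum_congr rfl fun i _ => ?_
            rw [lintegral_indicator (hEm i), setLIntegral_const, mul_comm]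
    -- The approximants have coefficients in a fixed box, whose image under a Lipschitz map is
    -- compact.
    have hcomp : IsCompact (Φ '' univ.pi fun i => Icc (-D i) (D i)) :=
      (isCompact_univ_pi fun i => isCompact_Icc).image hΦlip.continuous
    obtain ⟨t, ht, hcov⟩ := EMetric.totallyBounded_iff.1 hcomp.totallyBounded ε'
      (pos_iff_ne_zero.2 hε'0)
    refine ⟨t, ht, ?_⟩
    rintro _ ⟨k, rfl⟩
    obtain ⟨c, hc, hck⟩ := happ (w k) (hwi k) (hwA k) (hwM k)
    obtain ⟨y, hy, hyc⟩ := mem_iUnion₂.1 (hcov ⟨c, fun i _ => hc i, rfl⟩)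
    refine mem_iUnion₂.2 ⟨y, hy, ?_⟩
    rw [Metric.mem_eball] at hyc ⊢
    calc edist (F k) y ≤ edist (F k) (Φ c) + edist (Φ c) y := edist_triangle _ _ _
      _ ≤ ε' + ε' := by
          refine add_le_add ?_ hyc.le
          rw [hF, hΦ]
          simp only
          rw [Integrable.edist_toL1_toL1]
          simpa only [edist_eq_enorm_sub] using hck
      _ < ε := hε'.2
  have hcpt : IsCompact (closure (range F)) :=
    htb.closure.isCompact_of_isClosed isClosed_closure
  obtain ⟨f, _, φ, hφ, hlim⟩ := hcpt.tendsto_subseq fun k => subset_closure (mem_range_self k)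
  refine ⟨f, φ, hφ, L1.integrable_coeFn f, ?_⟩
  rw [tendsto_iff_edist_tendsto_0] at hlim
  refine hlim.congr fun k => ?_
  rw [Function.comp_apply, hF]
  simp only
  rw [← Integrable.toL1_coeFn f (L1.integrable_coeFn f), Integrable.edist_toL1_toL1,
    Integrable.toL1_coeFn]
  simp only [edist_eq_enorm_sub]
  rfl

end Poincare

/-! ### Energy bound, passage to the limit, and the stability theorem -/

section Stability

theorem ae_eq_zero_of_notMem_closure {X : Type*} [MetricSpace X] [MeasurableSpace X]
    {μ : Measure X} {Ω : Set X} {w : X → ℝ} (hw : ∀ᵐ x ∂μ, x ∉ Ω → w x = 0) :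
    ∀ᵐ x ∂μ, x ∉ closure Ω → w x = 0 :=
  hw.mono fun _ hx hxc => hx fun h => hxc (subset_closure h)

variable {X : Type*} [MetricSpace X] [MeasurableSpace X] [BorelSpace X] [ProperSpace X]
  {μ : Measure X} {Ω : Set X}

/-- The energy of a solution relative to its boundary data. -/
theorem SolvesDirichlet.variationOpen_sub_le (hΩb : Bornology.IsBounded Ω) {f u : X → ℝ}
    (hf : MemBV μ f) (h : SolvesDirichlet μ Ω f u) :
    variationOpen μ (u - f) univ ≤ variation μ f univ + variation μ f univ := by
  obtain ⟨hu, ⟨huf, hzero⟩, hmin⟩ := h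
  -- This perturbation turns `u` into the competitor `f`.
  have hcomp : MemBVZero μ Ω (f - u) :=
    ⟨hf.sub hu, hzero.mono fun x hx hxΩ => by
      have := hx hxΩ
      rw [Pi.sub_apply] at this ⊢
      linarith⟩
  have hle := hmin _ hcomp
  rw [add_sub_cancel] at hle
  calc variationOpen μ (u - f) univ ≤ variation μ (u - f) (closure Ω) :=
        variationOpen_univ_le_variation_of_ae_eq_zero hΩb.isCompact_closure
          huf.1.aestronglyMeasurable (ae_eq_zero_of_notMem_closure hzero)
    _ ≤ variation μ u (closure Ω) + variation μ f (closure Ω) :=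
        variation_sub_le _ _ _ hu.1.aestronglyMeasurable
    _ ≤ variation μ f univ + variation μ f univ :=
        add_le_add (hle.trans (variation_mono f (subset_univ _))) (variation_mono f (subset_univ _))

/-- Limits of solutions with converging boundary data are solutions. -/
theorem solvesDirichlet_of_tendsto (hΩb : Bornology.IsBounded Ω) {f u : ℕ → X → ℝ}
    {f₀ u₀ : X → ℝ} (hf : ∀ k, MemBV μ (f k)) (hf₀ : MemBV μ f₀)
    (hu : ∀ k, SolvesDirichlet μ Ω (f k) (u k)) (hu₀ : MemBV μ u₀)
    (hzero : ∀ᵐ x ∂μ, x ∉ Ω → (u₀ - f₀) x = 0)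
    (hlim : Tendsto (fun k => variation μ (f k - f₀) univ) atTop (𝓝 0))
    (hw : TendstoL1 μ (fun k => u k - f k) (u₀ - f₀) univ) : SolvesDirichlet μ Ω f₀ u₀ := by
  refine ⟨hu₀, ⟨hu₀.sub hf₀, hzero⟩, fun g hg => ?_⟩
  have hwm : ∀ k, AEStronglyMeasurable (u k - f k + f₀) μ := fun k =>
    (((hu k).1.1.sub (hf k).1).add hf₀.1).aestronglyMeasurable
  have hvar0 : variationOpen μ u₀ univ ≠ ∞ := by
    rw [← variation_of_isOpen _ isOpen_univ]
    exact hu₀.2.ne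
  refine ENNReal.le_of_forall_pos_le_add fun ε hε _ => ?_
  have hε2 : ((ε / 2 : ℝ≥0) : ℝ≥0∞) ≠ 0 := by simpa using (half_pos hε).ne'
  refine variation_compact_le_of_tendsto hΩb.isCompact_closure hwm (fun k => ?_) ?_ hvar0
    (Eventually.frequently ?_)
  · filter_upwards [hzero, (hu k).2.1.2] with x hx hxk hxc
    have hxΩ : x ∉ Ω := fun h => hxc (subset_closure h)
    have h1 := hx hxΩ
    have h2 := hxk hxΩ
    simp only [Pi.add_apply, Pi.sub_apply] at *
    linarith
  · intro V _
    refine tendsto_of_tendsto_of_tendsto_of_le_of_le tendsto_const_nhds hw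
      (fun _ => zero_le) fun k => ?_
    refine (lintegral_mono_set (subset_univ V)).trans (le_of_eq (lintegral_congr fun x => ?_))
    simp only [Pi.add_apply, Pi.sub_apply]
    congr 1
    ring
  · filter_upwards [hlim.eventually (Iic_mem_nhds (pos_iff_ne_zero.2 hε2))] with k hk
    have hdk : ∀ A : Set X, variation μ (f k - f₀) A ≤ (ε / 2 : ℝ≥0) := fun A =>
      (variation_mono _ (subset_univ A)).trans hk
    -- This perturbation turns `u k` into `u₀ + g + (f k - f₀)`, which has the boundary data `f k`.
    have hcomp : MemBVZero μ Ω (u₀ + g - f₀ + f k - u k) := by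
      refine ⟨(((hu₀.add hg.1).sub hf₀).add (hf k)).sub (hu k).1, ?_⟩
      filter_upwards [hzero, (hu k).2.1.2, hg.2] with x hx hxk hxg hxΩ
      have h1 := hx hxΩ
      have h2 := hxk hxΩ
      have h3 := hxg hxΩ
      simp only [Pi.add_apply, Pi.sub_apply] at *
      linarith
    have hmin := (hu k).2.2 _ hcomp
    rw [show u k + (u₀ + g - f₀ + f k - u k) = (u₀ + g) + (f k - f₀) by ring] at hmin
    calc variation μ (u k - f k + f₀) (closure Ω)
        = variation μ (u k - (f k - f₀)) (closure Ω) := by rw [sub_sub_eq_add_sub, sub_add_eq_add_sub]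
      _ ≤ variation μ (u k) (closure Ω) + variation μ (f k - f₀) (closure Ω) :=
          variation_sub_le _ _ _ (hu k).1.1.aestronglyMeasurable
      _ ≤ (variation μ (u₀ + g) (closure Ω) + variation μ (f k - f₀) (closure Ω))
            + variation μ (f k - f₀) (closure Ω) := by
          gcongr
          exact hmin.trans (variation_add_le _ _ _ (hu₀.1.add hg.1.1).aestronglyMeasurable)
      _ ≤ (variation μ (u₀ + g) (closure Ω) + (ε / 2 : ℝ≥0)) + (ε / 2 : ℝ≥0) := by
          gcongr <;> exact hdk _
      _ = variation μ (u₀ + g) (closure Ω) + ε := by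
          rw [add_assoc, ← ENNReal.coe_add, add_halves]

end Stability

end MetricBV

theorem proposition3p3 {X : Type*} [MetricSpace X] [CompleteSpace X]
    [MeasurableSpace X] [BorelSpace X] (μ : Measure X)
    (hdoubling : MetricBV.IsDoubling μ) (hpoincare : MetricBV.SupportsPoincare μ)
    (Ω : Set X) (hΩ : IsOpen Ω) (hΩb : Bornology.IsBounded Ω) (hΩc : 0 < μ Ωᶜ)
    (f : ℕ → X → ℝ) (f₀ : X → ℝ) (u : ℕ → X → ℝ)
    (hf : ∀ k, MetricBV.MemBV μ (f k)) (hf₀ : MetricBV.MemBV μ f₀)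
    (hu : ∀ k, MetricBV.SolvesDirichlet μ Ω (f k) (u k))
    (hlim : MetricBV.TendstoBV μ f f₀) :
    ∃ u₀ : X → ℝ, MetricBV.MemBV μ u₀ ∧
      (∃ φ : ℕ → ℕ, StrictMono φ ∧ MetricBV.TendstoL1 μ (fun k => u (φ k)) u₀ Ω) ∧
      MetricBV.SolvesDirichlet μ Ω f₀ u₀ := by
  obtain ⟨cd, hcd⟩ := hdoubling
  have hd : MetricBV.DoublingWith μ cd := hcd
  have hproper : ProperSpace X := hd.properSpace
  have hlimL1 : Tendsto (fun k => ∫⁻ x, ‖f k x - f₀ x‖ₑ ∂μ) atTop (𝓝 0) :=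
    tendsto_of_tendsto_of_tendsto_of_le_of_le tendsto_const_nhds hlim
      (fun _ => zero_le) fun _ => le_self_add
  have hlimV : Tendsto (fun k => MetricBV.variation μ (f k - f₀) univ) atTop (𝓝 0) :=
    tendsto_of_tendsto_of_tendsto_of_le_of_le tendsto_const_nhds hlim
      (fun _ => zero_le) fun _ => le_add_self
  obtain ⟨k₀, hk₀⟩ := eventually_atTop.1 (hlimV.eventually (Iic_mem_nhds one_pos))
  set V₀ := MetricBV.variation μ f₀ univ with hV₀
  -- Twice the bound `1 + V₀` for the boundary data from `k₀` on; the last `1` makes the inequality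
  -- strict.
  set M : ℝ≥0∞ := (1 + V₀) + (1 + V₀) + 1 with hM
  have hMt : M ≠ ∞ := by
    have : V₀ ≠ ∞ := hf₀.2.ne
    finiteness
  have hzero : ∀ k, ∀ᵐ x ∂μ, x ∉ Ω → (u k - f k) x = 0 := fun k => (hu k).2.1.2
  have hvar : ∀ k, k₀ ≤ k → MetricBV.variationOpen μ (u k - f k) univ < M := by
    intro k hk
    have hfk : MetricBV.variation μ (f k) univ ≤ 1 + V₀ := by
      calc MetricBV.variation μ (f k) univ = MetricBV.variation μ ((f k - f₀) + f₀) univ := by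
            rw [sub_add_cancel]
        _ ≤ MetricBV.variation μ (f k - f₀) univ + V₀ :=
            MetricBV.variation_add_le _ _ _ ((hf k).1.sub hf₀.1).aestronglyMeasurable
        _ ≤ 1 + V₀ := add_le_add (hk₀ k hk) le_rfl
    refine (((hu k).variationOpen_sub_le hΩb (hf k)).trans (add_le_add hfk hfk)).trans_lt ?_
    refine ENNReal.lt_add_right ?_ one_ne_zero
    have : V₀ ≠ ∞ := hf₀.2.ne
    finiteness
  obtain ⟨C, hC, hmaz⟩ := MetricBV.exists_lintegral_le_mul_variationOpen hd hpoincare hΩ hΩb hΩc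
  have hwi : ∀ k, Integrable (u k - f k) μ := fun k => (hu k).1.1.sub (hf k).1
  obtain ⟨v, φ, hφ, hv, hvlim⟩ := MetricBV.exists_subseq_tendstoL1 hd hpoincare hΩb
    (ENNReal.mul_ne_top hC hMt) hMt (w := fun k => u (k₀ + k) - f (k₀ + k)) (fun k => hwi _)
    (fun k => hmaz _ M (hwi _) (hzero _) (hvar _ (Nat.le_add_right _ _)))
    (fun k => hvar _ (Nat.le_add_right _ _))
  set ψ : ℕ → ℕ := fun k => k₀ + φ k with hψ
  have hψmono : StrictMono ψ := fun a b hab => Nat.add_lt_add_left (hφ hab) _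
  -- The limit is controlled only on `Ω`; extension by zero matches the differences, which vanish
  -- off `Ω`.
  set v₀ : X → ℝ := Ω.indicator v with hv₀
  have hv₀i : Integrable v₀ μ := (integrable_indicator_iff hΩ.measurableSet).2 hv
  have hw : MetricBV.TendstoL1 μ (fun k => u (ψ k) - f (ψ k)) v₀ univ := by
    refine hvlim.congr fun k => ?_
    rw [Measure.restrict_univ, ← lintegral_indicator hΩ.measurableSet]
    refine lintegral_congr_ae ?_
    filter_upwards [hzero (ψ k)] with x hx
    by_cases hxΩ : x ∈ Ω
    · rw [indicator_of_mem hxΩ, hv₀, indicator_of_mem hxΩ]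
    · rw [indicator_of_notMem hxΩ, hv₀, indicator_of_notMem hxΩ, hx hxΩ]
      simp
  have hv₀BV : MetricBV.MemBV μ v₀ := by
    refine ⟨hv₀i, ?_⟩
    rw [MetricBV.variation_of_isOpen _ isOpen_univ]
    refine lt_of_le_of_lt (MetricBV.variationOpen_le_of_tendsto isOpen_univ
      (fun k => (hwi (ψ k)).aestronglyMeasurable) (fun V _ => ?_)
      (Eventually.frequently (Eventually.of_forall fun k =>
        (hvar (ψ k) (Nat.le_add_right _ _)).le))) hMt.lt_top
    exact tendsto_of_tendsto_of_tendsto_of_le_of_le tendsto_const_nhds hw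
      (fun _ => zero_le) fun k => lintegral_mono_set (subset_univ V)
  have hu₀ : MetricBV.MemBV μ (f₀ + v₀) := hf₀.add hv₀BV
  have hsub : f₀ + v₀ - f₀ = v₀ := add_sub_cancel_left _ _
  refine ⟨f₀ + v₀, hu₀, ⟨ψ, hψmono, ?_⟩, ?_⟩
  · have hsum := (hw.add (hlimL1.comp hψmono.tendsto_atTop))
    rw [add_zero] at hsum
    refine tendsto_of_tendsto_of_tendsto_of_le_of_le tendsto_const_nhds hsum
      (fun _ => zero_le) fun k => ?_
    simp only [Function.comp_apply]
    have hm : AEMeasurable (fun x => ‖(u (ψ k) - f (ψ k)) x - v₀ x‖ₑ) μ :=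
      ((hwi (ψ k)).aestronglyMeasurable.sub hv₀i.aestronglyMeasurable).enorm
    rw [Measure.restrict_univ, ← lintegral_add_left' hm]
    refine (setLIntegral_le_lintegral _ _).trans (lintegral_mono fun x => ?_)
    calc ‖u (ψ k) x - (f₀ + v₀) x‖ₑ
        = ‖((u (ψ k) - f (ψ k)) x - v₀ x) + (f (ψ k) x - f₀ x)‖ₑ := by
          simp only [Pi.add_apply, Pi.sub_apply]
          congr 1
          ring
      _ ≤ _ := enorm_add_le _ _
  · refine MetricBV.solvesDirichlet_of_tendsto hΩb (fun k => hf (ψ k)) hf₀ (fun k => hu (ψ k)) hu₀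
      (Eventually.of_forall fun x hx => ?_) (hlimV.comp hψmono.tendsto_atTop) ?_
    · rw [hsub, hv₀, indicator_of_notMem hx]
    · rwa [hsub]
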